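/- Let $\hbar\in\mathbb R$ and let $A_\hbar=C(\mathbb T)\rtimes_\hbar\mathbb Z$ be the rotation algebra ($\mathbb T=\mathbb R/\mathbb Z$), i.e. the universal C*-algebra generated by unitaries $U,V$ with $UV=e^{2\pi i\hbar}VU$. Let $A_\hbar^\infty\subset A_\hbar$ be the set of all sums $\sum_{n,m\in\mathbb Z}c_{nm}U^nV^m$ with $\sum|c_{nm}|(1+n^2+m^2)^k<\infty$ for every $k\in\mathbb N$, let $\tau$ be the standard trace on $A_\hbar$ (so $\tau(\sum c_{nm}U^nV^m)=c_{00}$), and let $\pi_\hbar:A_\hbar\to\mathbb B(L^2(\mathbb R))$ be the representation with $(\pi_\hbar(U)\xi)(x)=e^{2\pi i x}\xi(x)$ and $(\pi_\hbar(V)\xi)(x)=\xi(x-\hbar)$. Let $H=-\frac{d^2}{dx^2}+x^2$ be the harmonic oscillator on $L^2(\mathbb R)$, which is diagonal in the orthonormal basis of Hermite functions with eigenvalues $1,3,5,\dots$. (a) For every $a\in A_\hbar^\infty$ the operator $\pi_\hbar(a)H^{-s}$ is trace class for $\mathrm{Re}(s)>1$, and the function $s\mapsto\mathrm{Tr}(\pi_\hbar(a)H^{-s})$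 on this half-plane extends to a meromorphic function on $\mathbb C$ that is holomorphic on $\mathbb C\setminus\{1\}$ and has at most a simple pole at $s=1$. If $\hbar\neq0$, then $$\mathrm{Res}_{s=1}\,\mathrm{Tr}(\pi_\hbar(a)H^{-s})=\tfrac12\,\tau(a),$$ and $s=1$ is a (simple) pole if and only if $\tau(a)\ne0$. (b) For every bounded uniformly continuous function $f:\mathbb R\to\mathbb C$ and every real $\alpha\neq0$, with $(U_\alpha\xi)(x)=\xi(x-\alpha)$, the operator $fU_\alpha H^{-s}$ is trace class for $\mathrm{Re}(s)>1$, and $s\mapsto\mathrm{Tr}(fU_\alpha H^{-s})$ extends to an entire function. -/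

import Mathlib

open MeasureTheory Filter Topology Complex
open scoped ENNReal SchwartzMap

noncomputable section

namespace Heisenberg

/-! ### The Hilbert space `L²(ℝ)`, multiplication and translation operators -/

/-- The Hilbert space `L²(ℝ)` of complex-valued functions. -/
abbrev L2R : Type := Lp ℂ 2 (volume : Measure ℝ)

/-- The bounded operators on `L²(ℝ)`. -/
abbrev Op : Type := L2R →L[ℂ] L2R

instance instNontrivialL2R : Nontrivial L2R := by
  refine ⟨⟨indicatorConstLp 2 (measurableSet_Ico (a := (0 : ℝ)) (b := 1)) (by simp) (1 : ℂ), 0, ?_⟩⟩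
  intro h
  have := congrArg norm h
  rw [norm_indicatorConstLp (by simp) (by simp)] at this
  simp at this

/-- The operator `ξ ↦ f ξ` of multiplication by an essentially bounded function `f`. -/
def mulOp (f : ℝ → ℂ) (hf : MemLp f ∞ volume) : Op :=
  (ContinuousLinearMap.mul ℂ ℂ).holderL volume ∞ 2 2 (hf.toLp f)

theorem coeFn_mulOp (f : ℝ → ℂ) (hf : MemLp f ∞ volume) (ξ : L2R) :
    mulOp f hf ξ =ᵐ[volume] fun x => f x * ξ x := by
  have h := (ContinuousLinearMap.mul ℂ ℂ).coeFn_holder (r := 2) (hf.toLp f) ξ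
  filter_upwards [h, hf.coeFn_toLp] with x hx hx'
  rw [← hx']
  exact hx

theorem memLp_boundedContinuous (f : BoundedContinuousFunction ℝ ℂ) :
    MemLp (fun x => f x) ∞ (volume : Measure ℝ) :=
  memLp_top_of_bound f.continuous.aestronglyMeasurable ‖f‖
    (Eventually.of_forall fun x => f.norm_coe_le_norm x)

theorem memLp_phase (g : ℝ → ℝ) (hg : Measurable g) :
    MemLp (fun x => exp (2 * Real.pi * g x * I)) ∞ (volume : Measure ℝ) := by
  refine memLp_top_of_bound (by fun_prop) 1 (Eventually.of_forall fun x => ?_)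
  have := Complex.norm_exp_ofReal_mul_I (2 * Real.pi * g x)
  push_cast at this
  exact this.le

theorem phase_inv_aux (g : ℝ → ℝ) (hg : Measurable g) (ξ : L2R) :
    mulOp _ (memLp_phase (fun x => -g x) hg.neg) (mulOp _ (memLp_phase g hg) ξ) = ξ := by
  refine Lp.ext ?_
  filter_upwards [coeFn_mulOp _ (memLp_phase (fun x => -g x) hg.neg)
    (mulOp _ (memLp_phase g hg) ξ), coeFn_mulOp _ (memLp_phase g hg) ξ] with x h1 h2
  rw [h1, h2, ← mul_assoc, ← exp_add]
  push_cast
  ring_nf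
  simp

/-- The unitary `ξ ↦ e^{2πi g} ξ` on `L²(ℝ)`, for a measurable real function `g`. -/
def phaseOp (g : ℝ → ℝ) (hg : Measurable g) : L2R ≃ₗᵢ[ℂ] L2R where
  toLinearEquiv := LinearEquiv.ofLinearMap
    (mulOp _ (memLp_phase g hg)).toLinearMap
    (mulOp _ (memLp_phase (fun x => -g x) hg.neg)).toLinearMap
    (by
      ext1 ξ
      have := phase_inv_aux (fun x => -g x) hg.neg ξ
      simp only [neg_neg] at this
      exact this)
    (by
      ext1 ξ
      exact phase_inv_aux g hg ξ)
  norm_map' ξ := by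
    change ‖mulOp _ (memLp_phase g hg) ξ‖ = ‖ξ‖
    rw [Lp.norm_def, Lp.norm_def]
    congr 1
    refine eLpNorm_congr_norm_ae ?_
    filter_upwards [coeFn_mulOp _ (memLp_phase g hg) ξ] with x hx
    have := Complex.norm_exp_ofReal_mul_I (2 * Real.pi * g x)
    push_cast at this
    rw [hx, norm_mul, this, one_mul]

theorem coeFn_phaseOp (g : ℝ → ℝ) (hg : Measurable g) (ξ : L2R) :
    phaseOp g hg ξ =ᵐ[volume] fun x => exp (2 * Real.pi * g x * I) * ξ x :=
  coeFn_mulOp _ (memLp_phase g hg) ξ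

/-- The translation unitary `U_α` on `L²(ℝ)`: `(U_α ξ)(x) = ξ (x - α)`. -/
def translation (α : ℝ) : L2R ≃ₗᵢ[ℂ] L2R where
  toLinearEquiv := LinearEquiv.ofLinearMap
    (Lp.compMeasurePreservingₗ ℂ (fun x : ℝ => x - α) (measurePreserving_sub_right volume α))
    (Lp.compMeasurePreservingₗ ℂ (fun x : ℝ => x + α) (measurePreserving_add_right volume α))
    (by
      refine LinearMap.ext fun ξ => ?_
      change Lp.compMeasurePreserving _ _ (Lp.compMeasurePreserving _ _ ξ) = ξ
      rw [← Lp.compMeasurePreserving_comp_apply]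
      have h : (fun x : ℝ => x + α) ∘ (fun x : ℝ => x - α) = id := by
        funext x
        simp
      simp only [h]
      exact Lp.compMeasurePreserving_id_apply ξ)
    (by
      refine LinearMap.ext fun ξ => ?_
      change Lp.compMeasurePreserving _ _ (Lp.compMeasurePreserving _ _ ξ) = ξ
      rw [← Lp.compMeasurePreserving_comp_apply]
      have h : (fun x : ℝ => x - α) ∘ (fun x : ℝ => x + α) = id := by
        funext x
        simp
      simp only [h]
      exact Lp.compMeasurePreserving_id_apply ξ)
  norm_map' ξ := Lp.norm_compMeasurePreserving ξ (measurePreserving_sub_right volume α)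

theorem coeFn_translation (α : ℝ) (ξ : L2R) :
    translation α ξ =ᵐ[volume] fun x => ξ (x - α) :=
  Lp.coeFn_compMeasurePreserving ξ (measurePreserving_sub_right volume α)

/-! ### The rotation algebra -/

/-- `u v = e^{2πiħ} v u`, equivalently `v u v⁻¹ = e^{-2πiħ} u`: the relation between the generator
`u(t) = e^{2πit}` of `C(𝕋)` and the unitary `v` implementing translation by `ħ` on `𝕋 = ℝ/ℤ`. -/
def RotationRelation (ħ : ℝ) (u v : Op) : Prop :=
  u * v = exp (2 * Real.pi * ħ * I) • (v * u)

/-- The pairs of unitaries on `L²(ℝ)` that satisfy the rotation relation; these are the covariant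
representations of `(C(𝕋), ℤ, ħ)` on the separable infinite-dimensional Hilbert space `L²(ℝ)`. -/
abbrev CovariantPair (ħ : ℝ) : Type :=
  {p : unitary Op × unitary Op // RotationRelation ħ p.1 p.2}

/-- The C⋆-algebra of bounded families of operators indexed by the covariant pairs. -/
abbrev BigProduct (ħ : ℝ) : Type := lp (fun _ : CovariantPair ħ => Op) ∞

instance instIsTopologicalRingBigProduct (ħ : ℝ) : IsTopologicalRing (BigProduct ħ) :=
  @NonUnitalSeminormedRing.toIsTopologicalRing (BigProduct ħ) _

instance instContinuousStarBigProduct (ħ : ℝ) : ContinuousStar (BigProduct ħ) :=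
  ⟨(LipschitzWith.of_dist_le_mul (K := 1) fun a b => by
    rw [dist_eq_norm, dist_eq_norm, NNReal.coe_one, one_mul]
    exact ((congrArg norm (star_sub a b)).symm.trans (norm_star (a - b))).le).continuous⟩

/-- A family of unitaries, as a unitary of the product C⋆-algebra. -/
def familyUnitary (ħ : ℝ) (w : CovariantPair ħ → unitary Op) : unitary (BigProduct ħ) :=
  ⟨⟨fun i => (w i : Op), memℓp_infty ⟨1, by
      rintro _ ⟨i, rfl⟩
      exact (CStarRing.norm_coe_unitary (w i)).le⟩⟩, by
    rw [Unitary.mem_iff]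
    constructor
    · ext1
      funext i
      exact Unitary.coe_star_mul_self (w i)
    · ext1
      funext i
      exact Unitary.coe_mul_star_self (w i)⟩

/-- The generator `U` (the function `t ↦ e^{2πit}` on the circle). -/
def bigU (ħ : ℝ) : unitary (BigProduct ħ) := familyUnitary ħ fun i => i.1.1

/-- The generator `V` (implementing the translation by `ħ`). -/
def bigV (ħ : ℝ) : unitary (BigProduct ħ) := familyUnitary ħ fun i => i.1.2

/-- The rotation algebra `A_ħ = C(𝕋) ⋊_ħ ℤ`: the universal C⋆-algebra generated by two unitaries
`U`, `V` with `U V = e^{2πiħ} V U`, realised as the closed ⋆-subalgebra generated by the universal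
pair of unitaries. (It is separable, so representations on one separable infinite-dimensional
Hilbert space suffice.) -/
def rotationAlgebra (ħ : ℝ) : StarSubalgebra ℂ (BigProduct ħ) :=
  (StarAlgebra.adjoin ℂ {(bigU ħ : BigProduct ħ), (bigV ħ : BigProduct ħ)}).topologicalClosure

/-- The representation of `A_ħ` on `L²(ℝ)` given by a covariant pair `(u, v)`; it maps `U` to `u`
and `V` to `v`. -/
def repOfPair (ħ : ℝ) (i : CovariantPair ħ) : rotationAlgebra ħ →⋆ₐ[ℂ] Op where
  toFun a := (a : BigProduct ħ) i
  map_one' := rfl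
  map_mul' _ _ := rfl
  map_zero' := rfl
  map_add' _ _ := rfl
  commutes' _ := rfl
  map_star' _ := rfl

/-- The Schwartz subalgebra `A_ħ^∞`: the elements `∑ c_{nm} U^n V^m` of `A_ħ` with
`∑ |c_{nm}| (1 + n² + m²)^k < ∞` for all `k`. -/
def schwartzAlgebra (ħ : ℝ) : Set (rotationAlgebra ħ) :=
  {a | ∃ c : ℤ × ℤ → ℂ,
    (∀ k : ℕ, Summable fun p : ℤ × ℤ => ‖c p‖ * (1 + (p.1 : ℝ) ^ 2 + (p.2 : ℝ) ^ 2) ^ k) ∧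
    HasSum (fun p : ℤ × ℤ =>
      c p • (((bigU ħ ^ p.1 : unitary (BigProduct ħ)) : BigProduct ħ) *
        ((bigV ħ ^ p.2 : unitary (BigProduct ħ)) : BigProduct ħ))) (a : BigProduct ħ)}

/-- Multiplication by `e^{2πi g}` and translation by `α` form a covariant pair as soon as
`g (x - α) = g x - ħ`. -/
theorem rotationRelation_phase_translation (ħ α : ℝ) (g : ℝ → ℝ) (hg : Measurable g)
    (h : ∀ x, g (x - α) = g x - ħ) :
    RotationRelation ħ (Unitary.linearIsometryEquiv.symm (phaseOp g hg) : Op)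
      (Unitary.linearIsometryEquiv.symm (translation α) : Op) := by
  refine ContinuousLinearMap.ext fun ξ => ?_
  change phaseOp g hg (translation α ξ) =
    exp (2 * Real.pi * ħ * I) • translation α (phaseOp g hg ξ)
  refine Lp.ext ?_
  have h3 := (measurePreserving_sub_right (volume : Measure ℝ) α).quasiMeasurePreserving.ae
    (coeFn_phaseOp g hg ξ)
  filter_upwards [coeFn_phaseOp g hg (translation α ξ), coeFn_translation α ξ,
    coeFn_translation α (phaseOp g hg ξ), h3,
    Lp.coeFn_smul (exp (2 * Real.pi * ħ * I)) (translation α (phaseOp g hg ξ))] with x h1 h2 h4 h5 h6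
  rw [h6, Pi.smul_apply, h4, h5, h1, h2, h, smul_eq_mul, ← mul_assoc, ← exp_add]
  congr 2
  push_cast
  ring

/-- The covariant pair `(u, v_ħ)` on `L²(ℝ)`: `(u ξ)(x) = e^{2πix} ξ(x)` and
`(v_ħ ξ)(x) = ξ(x - ħ)`. -/
def heisenbergPair (ħ : ℝ) : CovariantPair ħ :=
  ⟨(Unitary.linearIsometryEquiv.symm (phaseOp (fun x => x) measurable_id),
    Unitary.linearIsometryEquiv.symm (translation ħ)),
    rotationRelation_phase_translation ħ ħ (fun x => x) measurable_id fun _ => rfl⟩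

/-- The representation `π_ħ : A_ħ → 𝔹(L²(ℝ))`. -/
def heisenbergRep (ħ : ℝ) : rotationAlgebra ħ →⋆ₐ[ℂ] Op := repOfPair ħ (heisenbergPair ħ)

theorem measurable_regularPhase (ħ : ℝ) :
    Measurable fun x : ℝ => Int.fract x + ħ * (⌊x⌋ : ℝ) := by
  fun_prop

/-- The regular representation of the crossed product on `L²(𝕋) ⊗ ℓ²(ℤ)`, the latter identified
with `L²(ℝ)` by `ℝ ∋ x ↔ (fract x, ⌊x⌋) ∈ [0, 1) × ℤ`: `f ∈ C(𝕋)` acts on the `n`-th copy of `L²(𝕋)`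
as multiplication by `t ↦ f(t + nħ)`, and `V` shifts the copies. -/
def regularPair (ħ : ℝ) : CovariantPair ħ :=
  ⟨(Unitary.linearIsometryEquiv.symm
      (phaseOp (fun x => Int.fract x + ħ * (⌊x⌋ : ℝ)) (measurable_regularPhase ħ)),
    Unitary.linearIsometryEquiv.symm (translation 1)),
    rotationRelation_phase_translation ħ 1 _ (measurable_regularPhase ħ) fun x => by
      rw [Int.fract_sub_one, Int.floor_sub_one]
      push_cast
      ring⟩

/-- The unit vector `1 ⊗ δ₀` of `L²(𝕋) ⊗ ℓ²(ℤ)`, that is, the indicator function of `[0, 1)`. -/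
def unitCell : L2R :=
  indicatorConstLp 2 (measurableSet_Ico (a := (0 : ℝ)) (b := 1)) (by simp) (1 : ℂ)

/-- The standard trace `τ` of `A_ħ`, `τ(∑ f_n V^n) = ∫_𝕋 f_0`: the vector state of `1 ⊗ δ₀` in the
regular representation. -/
def standardTrace (ħ : ℝ) (a : rotationAlgebra ħ) : ℂ :=
  inner ℂ unitCell (repOfPair ħ (regularPair ħ) a unitCell)

/-! ### The harmonic oscillator -/

/-- The operator `x` on Schwartz functions. -/
def position : 𝓢(ℝ, ℂ) →L[ℂ] 𝓢(ℝ, ℂ) := SchwartzMap.smulLeftCLM ℂ fun x : ℝ => (x : ℂ)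

/-- The operator `d/dx` on Schwartz functions. -/
def ddx : 𝓢(ℝ, ℂ) →L[ℂ] 𝓢(ℝ, ℂ) := SchwartzMap.derivCLM ℂ ℂ

/-- The harmonic oscillator `H = -d²/dx² + x²` on Schwartz functions. -/
def oscillator : 𝓢(ℝ, ℂ) →L[ℂ] 𝓢(ℝ, ℂ) := -(ddx * ddx) + position * position

/-- The creation operator `A* = x - d/dx` on Schwartz functions. -/
def creation : 𝓢(ℝ, ℂ) →L[ℂ] 𝓢(ℝ, ℂ) := position - ddx

theorem abs_pow_mul_gaussian_le (m : ℕ) (x : ℝ) :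
    |x| ^ m * Real.exp (-(x ^ 2 / 2)) ≤ m.factorial * Real.exp (1 / 2) := by
  have h1 : |x| ^ m ≤ m.factorial * Real.exp |x| := by
    have := Real.pow_div_factorial_le_exp |x| (abs_nonneg x) m
    rwa [div_le_iff₀ (by positivity), mul_comm] at this
  calc |x| ^ m * Real.exp (-(x ^ 2 / 2))
      ≤ m.factorial * Real.exp |x| * Real.exp (-(x ^ 2 / 2)) := by gcongr
    _ = m.factorial * Real.exp (|x| - x ^ 2 / 2) := by
        rw [mul_assoc, ← Real.exp_add, sub_eq_add_neg]
    _ ≤ m.factorial * Real.exp (1 / 2) := by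
        gcongr
        nlinarith [sq_nonneg (|x| - 1), sq_abs x]

theorem gaussian_decay (k n : ℕ) : ∃ C, ∀ x : ℝ,
    ‖x‖ ^ k * ‖iteratedFDeriv ℝ n (fun y : ℝ => Real.exp (-(y ^ 2 / 2))) x‖ ≤ C := by
  refine ⟨∑ i ∈ Finset.range ((Polynomial.hermite n).natDegree + 1),
    ‖((Polynomial.hermite n).coeff i : ℝ)‖ * ((k + i).factorial * Real.exp (1 / 2)), fun x => ?_⟩
  rw [norm_iteratedFDeriv_eq_norm_iteratedDeriv, iteratedDeriv_eq_iterate,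
    Polynomial.deriv_gaussian_eq_hermite_mul_gaussian, norm_mul, norm_mul, norm_pow, norm_neg,
    norm_one, one_pow, one_mul, Polynomial.aeval_eq_sum_range]
  calc ‖x‖ ^ k * (‖∑ i ∈ Finset.range ((Polynomial.hermite n).natDegree + 1),
        (Polynomial.hermite n).coeff i • x ^ i‖ * ‖Real.exp (-(x ^ 2 / 2))‖)
      ≤ ‖x‖ ^ k * ((∑ i ∈ Finset.range ((Polynomial.hermite n).natDegree + 1),
        ‖(Polynomial.hermite n).coeff i • x ^ i‖) * ‖Real.exp (-(x ^ 2 / 2))‖) := by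
        gcongr
        exact norm_sum_le _ _
    _ = ∑ i ∈ Finset.range ((Polynomial.hermite n).natDegree + 1),
        ‖((Polynomial.hermite n).coeff i : ℝ)‖ * (|x| ^ (k + i) * Real.exp (-(x ^ 2 / 2))) := by
        rw [Finset.sum_mul, Finset.mul_sum]
        refine Finset.sum_congr rfl fun i _ => ?_
        rw [zsmul_eq_mul, norm_mul, norm_pow, Real.norm_eq_abs x, Real.norm_eq_abs (Real.exp _),
          Real.abs_exp, pow_add]
        ring
    _ ≤ _ := by
        refine Finset.sum_le_sum fun i _ => ?_
        exact mul_le_mul_of_nonneg_left (abs_pow_mul_gaussian_le (k + i) x) (norm_nonneg _)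

/-- The Gaussian `e^{-x²/2}` as a Schwartz function. -/
def gaussian : 𝓢(ℝ, ℝ) where
  toFun x := Real.exp (-(x ^ 2 / 2))
  smooth' := by fun_prop
  decay' := gaussian_decay

/-- The eigenfunctions of `H`: `ψ₀ = π^{-1/4} e^{-x²/2}` and `ψ_{k+1} = (2(k+1))^{-1/2} A* ψ_k`. -/
def eigenfunction : ℕ → 𝓢(ℝ, ℂ)
  | 0 => ((Real.pi ^ (-(1 / 4) : ℝ) : ℝ) : ℂ) •
      SchwartzMap.postcompCLM (𝕜 := ℝ) Complex.ofRealCLM gaussian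
  | k + 1 => (((2 * ((k : ℝ) + 1)) ^ (-(1 / 2) : ℝ) : ℝ) : ℂ) • creation (eigenfunction k)

theorem position_apply (f : 𝓢(ℝ, ℂ)) (x : ℝ) : position f x = x * f x := by
  rw [position, SchwartzMap.smulLeftCLM_apply_apply (by fun_prop), smul_eq_mul]

theorem ddx_apply (f : 𝓢(ℝ, ℂ)) (x : ℝ) : ddx f x = deriv f x := rfl

theorem ddx_position (f : 𝓢(ℝ, ℂ)) : ddx (position f) = f + position (ddx f) := by
  ext x
  have h : (position f : ℝ → ℂ) = fun x : ℝ => (x : ℂ) * f x := funext (position_apply f)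
  rw [ddx_apply, h, add_apply, position_apply, ddx_apply]
  have := (Complex.ofRealCLM.hasDerivAt (x := x)).mul (f.hasDerivAt x)
  refine (this.deriv.trans ?_ :)
  simp

theorem ddx_eigenfunction_zero : ddx (eigenfunction 0) = -position (eigenfunction 0) := by
  ext x
  have h : (eigenfunction 0 : ℝ → ℂ) = fun x : ℝ =>
      ((Real.pi ^ (-(1 / 4) : ℝ) : ℝ) : ℂ) * ((Real.exp (-(x ^ 2 / 2)) : ℝ) : ℂ) := rfl
  rw [ddx_apply, neg_apply, position_apply, h]
  have h1 : HasDerivAt (fun x : ℝ => Real.exp (-(x ^ 2 / 2))) (Real.exp (-(x ^ 2 / 2)) * -x) x := by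
    have := (((hasDerivAt_id x).pow 2).div_const 2).neg.exp
    refine this.congr_deriv ?_
    simp
  have := (h1.ofReal_comp.const_mul ((Real.pi ^ (-(1 / 4) : ℝ) : ℝ) : ℂ)).deriv
  rw [this]
  push_cast
  ring

/-- `ψ_k` is an eigenvector of the harmonic oscillator with eigenvalue `2k + 1`. -/
theorem oscillator_eigenfunction (k : ℕ) :
    oscillator (eigenfunction k) = (2 * (k : ℂ) + 1) • eigenfunction k := by
  induction k with
  | zero =>
    change -ddx (ddx (eigenfunction 0)) + position (position (eigenfunction 0)) = _
    rw [ddx_eigenfunction_zero, map_neg, ddx_position, ddx_eigenfunction_zero, map_neg]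
    simp
  | succ k ih =>
    have hcomm : ∀ f, oscillator (creation f) = creation (oscillator f) + (2 : ℂ) • creation f := by
      intro f
      change -ddx (ddx (position f - ddx f)) + position (position (position f - ddx f)) =
        (position (-ddx (ddx f) + position (position f)) -
          ddx (-ddx (ddx f) + position (position f))) + (2 : ℂ) • (position f - ddx f)
      simp only [map_sub, map_add, map_neg, ddx_position, two_smul]
      abel
    rw [eigenfunction, map_smul, hcomm, ih, map_smul, smul_comm]
    rw [← add_smul]
    congr 2
    push_cast
    ring

/-- The vector of `L²(ℝ)` given by `ψ_k`; these vectors form an orthonormal basis of `L²(ℝ)`. -/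
def eigenvector (k : ℕ) : L2R := (eigenfunction k).toLp 2 volume

/-- The complex power `H^{-s}`, for `Re s > 1`, of the (self-adjoint extension of the) harmonic
oscillator: the operator that is diagonal in the basis `ψ_k` with eigenvalues `(2k + 1)^{-s}`, as
the norm-convergent sum `∑ (2k + 1)^{-s} ⟨ψ_k, ·⟩ ψ_k`. -/
def oscillatorPow (s : ℂ) : Op :=
  ∑' k : ℕ, (2 * (k : ℂ) + 1) ^ (-s) • InnerProductSpace.rankOne ℂ (eigenvector k) (eigenvector k)

/-! ### Traces -/

/-- `T` is trace class (nuclear): `T = ∑ ⟨y_n, ·⟩ x_n` with `∑ ‖x_n‖ ‖y_n‖ < ∞`. -/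
def IsTraceClass (T : Op) : Prop :=
  ∃ x y : ℕ → L2R, Summable (fun n => ‖x n‖ * ‖y n‖) ∧
    HasSum (fun n => InnerProductSpace.rankOne ℂ (x n) (y n)) T

/-- `T` is trace class and its trace is `c`: `∑ ⟨e_i, T e_i⟩ = c` for every Hilbert basis. -/
def HasTrace (T : Op) (c : ℂ) : Prop :=
  IsTraceClass T ∧
    ∀ (ι : Type) (e : HilbertBasis ι ℂ L2R), HasSum (fun i => inner ℂ (e i) (T (e i))) c

end Heisenberg

end

/-!
By Mehler's formula the heat semigroup `e^{-yH}` has an explicit Gaussian kernel, so the heat trace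
`Tr (g U_q e^{-yH})` of a multiplication operator times a translation is an explicit integral. Its
modulus is at most `‖g‖ e^{-q² / (4 tanh y)} / (2 sinh y)`, and for `g x = e^{ipx}` it equals
`e^{-(p² + q²) / (4 tanh y)} / (2 sinh y)`. When `q ≠ 0`, respectively `(p, q) ≠ (0, 0)`, this
vanishes to infinite order as `y → 0`, so that
`Tr (T H^{-s}) = Γ(s)⁻¹ ∫₀^∞ y^{s-1} Tr (T e^{-yH}) dy` is entire. In an absolutely convergent
series `∑ c_{nm} U^n V^m` the exponents of the nonscalar monomials are bounded away from `0`, and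
hence only the scalar part `c` contributes a pole: `c Tr H^{-s} = c 2^{-s} ζ(s, 1/2)` has residue
`c / 2` at `s = 1`. If `ħ ≠ 0`, then `c = c_{00} = τ(a)`.
-/

noncomputable section

namespace Heisenberg

/-! ### Mehler's formula -/

section Mehler

open ProbabilityTheory

theorem integral_pow_mul_cexp_gaussianReal (k : ℕ) (x : ℝ) :
    ∫ u, (-u * I) ^ k * exp (x * u * I) ∂gaussianReal 0 1 =
      ((Polynomial.aeval x (Polynomial.hermite k) * Real.exp (-(x ^ 2 / 2)) : ℝ) : ℂ) := by
  have hchar : charFun (gaussianReal 0 1) =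
      fun x : ℝ => ((Real.exp (-(x ^ 2 / 2)) : ℝ) : ℂ) := by
    funext x
    rw [charFun_gaussianReal]
    push_cast
    ring_nf
  have hderiv : iteratedDeriv k (fun x : ℝ => ((Real.exp (-(x ^ 2 / 2)) : ℝ) : ℂ)) x =
      ((iteratedDeriv k (fun x : ℝ => Real.exp (-(x ^ 2 / 2))) x : ℝ) : ℂ) := by
    have hsmooth : ContDiff ℝ k fun x : ℝ => Real.exp (-(x ^ 2 / 2)) := by fun_prop
    have h := Complex.ofRealCLM.iteratedFDeriv_comp_left (x := x) hsmooth.contDiffAt le_rfl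
    exact congrArg (fun M : ℝ [×k]→L[ℝ] ℂ => M fun _ => 1) h
  have hmoment := iteratedDeriv_charFun (t := x) (memLp_id_gaussianReal (μ := 0) (v := 1) k)
  rw [hchar, hderiv, iteratedDeriv_eq_iterate,
    Polynomial.deriv_gaussian_eq_hermite_mul_gaussian] at hmoment
  calc ∫ u, (-u * I) ^ k * exp (x * u * I) ∂gaussianReal 0 1
      = (-1) ^ k * (I ^ k * ∫ u, (u : ℂ) ^ k * exp (x * u * I) ∂gaussianReal 0 1) := by
        rw [← mul_assoc, ← mul_pow, ← integral_const_mul]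
        congr with u
        rw [← mul_assoc, ← mul_pow]
        ring_nf
    _ = _ := by
        rw [← hmoment]
        push_cast
        rw [mul_assoc, ← mul_assoc, ← mul_pow, neg_one_mul, neg_neg, one_pow, one_mul]

theorem integrable_exp_sq_gaussianReal {c : ℝ} (hc : c < 1) :
    Integrable (fun u => Real.exp (c * (u ^ 2 / 2))) (gaussianReal 0 1) := by
  rw [gaussianReal_of_var_ne_zero 0 one_ne_zero,
    integrable_withDensity_iff_integrable_smul' (measurable_gaussianPDF 0 1)
      (Eventually.of_forall fun _ => gaussianPDF_lt_top)]
  have h := (integrable_exp_neg_mul_sq (b := (1 - c) / 2) (by linarith)).const_mul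
    (√(2 * Real.pi))⁻¹
  refine h.congr (Eventually.of_forall fun u => ?_)
  simp only [toReal_gaussianPDF, gaussianPDFReal, smul_eq_mul, NNReal.coe_one, mul_one, sub_zero]
  rw [mul_assoc, ← Real.exp_add]
  ring_nf

theorem integral_cexp_linear_gaussianReal (z : ℂ) :
    ∫ u : ℝ, exp (z * u) ∂gaussianReal 0 1 = exp (z ^ 2 / 2) := by
  have h := complexMGF_gaussianReal (p := gaussianReal 0 1) (X := id) Measure.map_id z
  simpa [complexMGF] using h

theorem integral_cexp_quadratic_gaussianReal {r : ℝ} (hr : |r| < 1) (z : ℂ) :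
    ∫ v : ℝ, exp (r ^ 2 * v ^ 2 / 2 + z * v) ∂gaussianReal 0 1 =
      ((√(1 - r ^ 2))⁻¹ : ℝ) * exp (z ^ 2 / (2 * (1 - r ^ 2))) := by
  have hr2 : 0 < 1 - r ^ 2 := by
    have := (sq_lt_one_iff_abs_lt_one r).mpr hr
    linarith
  rw [integral_gaussianReal_eq_integral_smul one_ne_zero]
  have hint : ∀ v : ℝ, gaussianPDFReal 0 1 v • exp (r ^ 2 * v ^ 2 / 2 + z * v) =
      ((√(2 * Real.pi))⁻¹ : ℝ) * exp ((-(1 - r ^ 2) / 2 : ℝ) * v ^ 2 + z * v + 0) := by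
    intro v
    simp only [gaussianPDFReal, real_smul, NNReal.coe_one, mul_one, sub_zero]
    push_cast
    rw [mul_assoc, ← exp_add]
    ring_nf
  simp only [hint]
  rw [integral_const_mul, integral_cexp_quadratic (by rw [ofReal_re]; linarith), ← mul_assoc]
  have hconst : ((√(2 * Real.pi))⁻¹ : ℝ) *
      (Real.pi / -((-(1 - r ^ 2) / 2 : ℝ) : ℂ)) ^ (1 / 2 : ℂ) = ((√(1 - r ^ 2))⁻¹ : ℝ) := by
    rw [← ofReal_neg, ← ofReal_div, show (1 / 2 : ℂ) = ((1 / 2 : ℝ) : ℂ) by norm_num,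
      ← ofReal_cpow (div_nonneg Real.pi_pos.le (by linarith)), ← Real.sqrt_eq_rpow, ← ofReal_mul,
      ← Real.sqrt_inv, ← Real.sqrt_inv, ← Real.sqrt_mul (by positivity)]
    congr 2
    field_simp
  rw [hconst]
  congr 2
  have : (1 - r ^ 2 : ℂ) ≠ 0 := mod_cast hr2.ne'
  push_cast
  field_simp
  ring

theorem integral_integral_cexp_gaussianReal {r : ℝ} (hr : |r| < 1) (x y : ℝ) :
    ∫ v : ℝ, ∫ u : ℝ, exp (-r * u * v + x * u * I + y * v * I)
        ∂gaussianReal 0 1 ∂gaussianReal 0 1 =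
      (((√(1 - r ^ 2))⁻¹ *
        Real.exp (-(x ^ 2 / 2) - (y - r * x) ^ 2 / (2 * (1 - r ^ 2))) : ℝ) : ℂ) := by
  have hinner : ∀ v : ℝ, ∫ u : ℝ, exp (-r * u * v + x * u * I + y * v * I) ∂gaussianReal 0 1 =
      exp (-(x ^ 2 / 2)) * exp (r ^ 2 * v ^ 2 / 2 + (y - r * x) * I * v) := by
    intro v
    have : ∀ u : ℝ, exp (-r * u * v + x * u * I + y * v * I) =
        exp (y * v * I) * exp ((x * I - r * v) * u) := by
      intro u
      rw [← exp_add]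
      ring_nf
    simp only [this]
    rw [integral_const_mul, integral_cexp_linear_gaussianReal, ← exp_add, ← exp_add]
    ring_nf
    rw [I_sq]
    ring_nf
  simp only [hinner]
  rw [integral_const_mul, integral_cexp_quadratic_gaussianReal hr, mul_left_comm, ← exp_add,
    mul_pow, I_sq]
  push_cast
  ring_nf

theorem integrable_exp_abs_mul_gaussianReal_prod {r : ℝ} (hr : |r| < 1) :
    Integrable (fun p : ℝ × ℝ => Real.exp |r * p.1 * p.2|)
      ((gaussianReal 0 1).prod (gaussianReal 0 1)) := by
  refine ((integrable_exp_sq_gaussianReal hr).mul_prod (integrable_exp_sq_gaussianReal hr)).mono'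
    (by fun_prop) (Eventually.of_forall fun p => ?_)
  rw [Real.norm_eq_abs, Real.abs_exp, ← Real.exp_add]
  gcongr
  rw [abs_mul, abs_mul, mul_assoc, ← mul_add]
  gcongr
  rw [← sq_abs p.1, ← sq_abs p.2]
  linarith [two_mul_le_add_sq |p.1| |p.2|]

theorem hasSum_pow_mul_cexp_mul_cexp (r u v x y : ℝ) :
    HasSum (fun k : ℕ => r ^ k / k.factorial *
        (((-v * I) ^ k * exp (y * v * I)) * ((-u * I) ^ k * exp (x * u * I))))
      (exp (-r * u * v + x * u * I + y * v * I)) := by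
  have hI : (-r * u * v : ℂ) = r * (-v * I) * (-u * I) := by
    linear_combination (-r * u * v : ℂ) * I_sq
  have h := (NormedSpace.expSeries_div_hasSum_exp (-r * u * v : ℂ)).mul_right
    (exp (x * u * I + y * v * I))
  rw [← exp_eq_exp_ℂ, ← exp_add, ← add_assoc] at h
  refine h.congr_fun fun k => ?_
  rw [hI, mul_pow _ (-u * I), mul_pow _ (-v * I), exp_add]
  ring

theorem hasSum_integral_mul_integral_gaussianReal {r : ℝ} (hr : |r| < 1) (x y : ℝ) :
    HasSum (fun k : ℕ => (r ^ k / k.factorial : ℂ) *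
        ((∫ v, (-v * I) ^ k * exp (y * v * I) ∂gaussianReal 0 1) *
          ∫ u, (-u * I) ^ k * exp (x * u * I) ∂gaussianReal 0 1))
      (∫ v : ℝ, ∫ u : ℝ, exp (-r * u * v + x * u * I + y * v * I)
        ∂gaussianReal 0 1 ∂gaussianReal 0 1) := by
  let F : ℕ → ℝ × ℝ → ℂ := fun k p => r ^ k / k.factorial *
    (((-p.1 * I) ^ k * exp (y * p.1 * I)) * ((-p.2 * I) ^ k * exp (x * p.2 * I)))
  have hF_norm : ∀ k p, ‖F k p‖ = |r * p.1 * p.2| ^ k / k.factorial := by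
    intro k p
    have hphase : ∀ a b : ℝ, ‖exp (a * b * I)‖ = 1 := fun a b => by
      rw [← ofReal_mul, norm_exp_ofReal_mul_I]
    simp only [F, norm_mul, norm_div, norm_pow, hphase, norm_neg, norm_I, norm_real, norm_natCast,
      Real.norm_eq_abs, mul_one, abs_mul]
    ring
  have hF_sum : ∀ p : ℝ × ℝ, HasSum (fun k => F k p)
      (exp (-r * p.2 * p.1 + x * p.2 * I + y * p.1 * I)) :=
    fun p => hasSum_pow_mul_cexp_mul_cexp r p.2 p.1 x y
  have hexp : ∀ p : ℝ × ℝ, HasSum (fun k => |r * p.1 * p.2| ^ k / k.factorial)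
      (Real.exp |r * p.1 * p.2|) := fun p => by
    rw [Real.exp_eq_exp_ℝ]
    exact NormedSpace.expSeries_div_hasSum_exp _
  have hlim : Integrable (fun p : ℝ × ℝ => exp (-r * p.2 * p.1 + x * p.2 * I + y * p.1 * I))
      ((gaussianReal 0 1).prod (gaussianReal 0 1)) := by
    refine (integrable_exp_abs_mul_gaussianReal_prod hr).mono' (by fun_prop)
      (Eventually.of_forall fun p => ?_)
    rw [← (hF_sum p).tsum_eq]
    exact tsum_of_norm_bounded (hexp p) fun k => (hF_norm k p).le
  have hF_int : ∀ k, (r ^ k / k.factorial : ℂ) *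
      ((∫ v, (-v * I) ^ k * exp (y * v * I) ∂gaussianReal 0 1) *
        ∫ u, (-u * I) ^ k * exp (x * u * I) ∂gaussianReal 0 1) =
      ∫ p, F k p ∂(gaussianReal 0 1).prod (gaussianReal 0 1) := fun k => by
    rw [← integral_prod_mul, ← integral_const_mul]
  rw [← integral_prod _ hlim]
  refine HasSum.congr_fun ?_ hF_int
  exact hasSum_integral_of_dominated_convergence (fun k p => |r * p.1 * p.2| ^ k / k.factorial)
    (fun k => by fun_prop) (fun k => Eventually.of_forall fun p => (hF_norm k p).le)
    (Eventually.of_forall fun p => (hexp p).summable)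
    (by simpa only [fun p => (hexp p).tsum_eq] using integrable_exp_abs_mul_gaussianReal_prod hr)
    (Eventually.of_forall hF_sum)

theorem hasSum_hermite_mul_hermite {r : ℝ} (hr : |r| < 1) (x y : ℝ) :
    HasSum (fun k : ℕ => r ^ k / k.factorial *
        ((Polynomial.aeval x (Polynomial.hermite k) * Real.exp (-(x ^ 2 / 2))) *
          (Polynomial.aeval y (Polynomial.hermite k) * Real.exp (-(y ^ 2 / 2)))))
      ((√(1 - r ^ 2))⁻¹ * Real.exp (-(x ^ 2 / 2) - (y - r * x) ^ 2 / (2 * (1 - r ^ 2)))) := by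
  have h := hasSum_integral_mul_integral_gaussianReal hr x y
  simp only [integral_pow_mul_cexp_gaussianReal, integral_integral_cexp_gaussianReal hr] at h
  rw [← hasSum_ofReal]
  convert h using 2
  push_cast
  ring

end Mehler

/-! ### The heat kernel of the harmonic oscillator -/

theorem hasDerivAt_hermite_mul_gaussian (k : ℕ) (x : ℝ) :
    HasDerivAt
      (fun x => Polynomial.aeval (√2 * x) (Polynomial.hermite k) * Real.exp (-(x ^ 2 / 2)))
      (x * (Polynomial.aeval (√2 * x) (Polynomial.hermite k) * Real.exp (-(x ^ 2 / 2))) -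
        √2 * (Polynomial.aeval (√2 * x) (Polynomial.hermite (k + 1)) * Real.exp (-(x ^ 2 / 2))))
      x := by
  have hpoly := ((Polynomial.hermite k).hasDerivAt_aeval (√2 * x)).comp x
    ((hasDerivAt_id x).const_mul √2)
  have hexp : HasDerivAt (fun x : ℝ => Real.exp (-(x ^ 2 / 2)))
      (Real.exp (-(x ^ 2 / 2)) * -x) x := by
    simpa using (((hasDerivAt_id x).pow 2).div_const 2).neg.exp
  refine (hpoly.mul hexp).congr_deriv ?_
  have hsqrt : √2 * √2 = (2 : ℝ) := Real.mul_self_sqrt zero_le_two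
  rw [Polynomial.hermite_succ, map_sub, map_mul, Polynomial.aeval_X]
  simp only [Function.comp_apply, mul_one]
  linear_combination (x * Polynomial.aeval (√2 * x) (Polynomial.hermite k) *
    Real.exp (-(x ^ 2 / 2))) * hsqrt

theorem eigenfunction_apply (k : ℕ) (x : ℝ) :
    eigenfunction k x =
      ((Real.pi ^ (-(1 / 4) : ℝ) * (k.factorial : ℝ) ^ (-(1 / 2) : ℝ) *
        (Polynomial.aeval (√2 * x) (Polynomial.hermite k) * Real.exp (-(x ^ 2 / 2))) : ℝ) : ℂ) := by
  induction k generalizing x with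
  | zero =>
    have h : eigenfunction 0 x =
        ((Real.pi ^ (-(1 / 4) : ℝ) : ℝ) : ℂ) * ((Real.exp (-(x ^ 2 / 2)) : ℝ) : ℂ) := rfl
    simp [h]
  | succ k ih =>
    have hderiv := ((hasDerivAt_hermite_mul_gaussian k x).const_mul
      (Real.pi ^ (-(1 / 4) : ℝ) * (k.factorial : ℝ) ^ (-(1 / 2) : ℝ))).ofReal_comp.deriv
    have hcreation : creation (eigenfunction k) x =
        x * eigenfunction k x - deriv (eigenfunction k) x := by
      rw [← position_apply, ← ddx_apply]
      rfl
    have hfactorial : (2 * ((k : ℝ) + 1)) ^ (-(1 / 2) : ℝ) * √2 *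
        (k.factorial : ℝ) ^ (-(1 / 2) : ℝ) = ((k + 1).factorial : ℝ) ^ (-(1 / 2) : ℝ) := by
      rw [Nat.factorial_succ, Nat.cast_mul, Real.mul_rpow (by positivity) (by positivity),
        Real.mul_rpow (by positivity) (by positivity), Real.sqrt_eq_rpow, mul_right_comm (2 ^ _),
        ← Real.rpow_add zero_lt_two]
      norm_num
    rw [← funext ih] at hderiv
    rw [eigenfunction, smul_apply, hcreation, hderiv, ih, smul_eq_mul, ← hfactorial]
    push_cast
    ring

/-- The integral kernel of `e^{-yH}` for `y > 0`, where `H` is the harmonic oscillator. -/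
def heatKernel (y x x' : ℝ) : ℝ :=
  (√(2 * Real.pi * Real.sinh (2 * y)))⁻¹ *
    Real.exp (-(Real.tanh y * (x + x') ^ 2 / 4) - (x - x') ^ 2 / (4 * Real.tanh y))

theorem heatKernel_nonneg (y x x' : ℝ) : 0 ≤ heatKernel y x x' := by
  unfold heatKernel
  positivity

theorem tanh_pos {y : ℝ} (hy : 0 < y) : 0 < Real.tanh y := by
  rw [Real.tanh_eq_sinh_div_cosh]
  exact div_pos (Real.sinh_pos_iff.mpr hy) (Real.cosh_pos y)

theorem tanh_eq_exp_neg_two_mul (y : ℝ) :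
    Real.tanh y = (1 - Real.exp (-(2 * y))) / (1 + Real.exp (-(2 * y))) := by
  rw [Real.tanh_eq, ← mul_div_mul_left _ _ (Real.exp_ne_zero (-y)), mul_sub, mul_add,
    ← Real.exp_add, ← Real.exp_add, neg_add_cancel, Real.exp_zero, ← two_mul, mul_neg]

theorem two_mul_sinh_two_mul_eq_exp (y : ℝ) :
    2 * Real.sinh (2 * y) = Real.exp y ^ 2 * (1 - Real.exp (-(2 * y)) ^ 2) := by
  rw [Real.sinh_eq, mul_sub, mul_one, ← Real.exp_nat_mul, ← Real.exp_nat_mul, ← Real.exp_add]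
  push_cast
  ring_nf

theorem heatKernel_eq_hermite_kernel {y : ℝ} (hy : 0 < y) (x x' : ℝ) :
    heatKernel y x x' =
      Real.exp (-y) * (√Real.pi)⁻¹ * Real.exp ((x ^ 2 + x' ^ 2) / 2) *
        ((√(1 - Real.exp (-(2 * y)) ^ 2))⁻¹ *
          Real.exp (-((√2 * x) ^ 2 / 2) - (√2 * x' - Real.exp (-(2 * y)) * (√2 * x)) ^ 2 /
            (2 * (1 - Real.exp (-(2 * y)) ^ 2)))) := by
  have hr : Real.exp (-(2 * y)) < 1 := Real.exp_lt_one_iff.mpr (by linarith)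
  have hr0 := Real.exp_pos (-(2 * y))
  rw [heatKernel, mul_right_comm 2, two_mul_sinh_two_mul_eq_exp, mul_assoc,
    Real.sqrt_mul (sq_nonneg _), Real.sqrt_sq (Real.exp_pos y).le, Real.sqrt_mul' _ Real.pi_pos.le,
    tanh_eq_exp_neg_two_mul]
  set r := Real.exp (-(2 * y))
  have hexponent : -((1 - r) / (1 + r) * (x + x') ^ 2 / 4) -
      (x - x') ^ 2 / (4 * ((1 - r) / (1 + r))) =
      (x ^ 2 + x' ^ 2) / 2 +
        (-((√2 * x) ^ 2 / 2) - (√2 * x' - r * (√2 * x)) ^ 2 / (2 * (1 - r ^ 2))) := by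
    have hsqrt : √2 ^ 2 = (2 : ℝ) := Real.sq_sqrt zero_le_two
    have hsub : 1 - r ≠ 0 := by linarith
    have hadd : 1 + r ≠ 0 := by linarith
    have hcross : (√2 * x' - r * (√2 * x)) ^ 2 = 2 * (x' - r * x) ^ 2 := by
      linear_combination (x' - r * x) ^ 2 * hsqrt
    rw [hcross, mul_pow, hsqrt, show 1 - r ^ 2 = (1 - r) * (1 + r) by ring]
    field_simp
    ring
  rw [hexponent, Real.exp_add, Real.exp_neg]
  ring

theorem hasSum_eigenfunction_mul_eigenfunction {y : ℝ} (hy : 0 < y) (x x' : ℝ) :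
    HasSum (fun k : ℕ => (Real.exp (-(2 * k + 1) * y) : ℂ) *
        (eigenfunction k x * eigenfunction k x'))
      (heatKernel y x x') := by
  have hr : |Real.exp (-(2 * y))| < 1 := by
    rw [Real.abs_exp]
    exact Real.exp_lt_one_iff.mpr (by linarith)
  have h := (hasSum_hermite_mul_hermite hr (√2 * x) (√2 * x')).mul_left
    (Real.exp (-y) * (√Real.pi)⁻¹ * Real.exp ((x ^ 2 + x' ^ 2) / 2))
  rw [← heatKernel_eq_hermite_kernel hy, ← hasSum_ofReal] at h
  refine h.congr_fun fun k => ?_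
  have hpi : Real.pi ^ (-(1 / 4) : ℝ) * Real.pi ^ (-(1 / 4) : ℝ) = (√Real.pi)⁻¹ := by
    rw [← Real.rpow_add Real.pi_pos, Real.sqrt_eq_rpow, ← Real.rpow_neg Real.pi_pos.le]
    norm_num
  have hfactorial : (k.factorial : ℝ) ^ (-(1 / 2) : ℝ) * (k.factorial : ℝ) ^ (-(1 / 2) : ℝ) =
      (k.factorial : ℝ)⁻¹ := by
    rw [← Real.rpow_add (by positivity), ← Real.rpow_neg_one]
    norm_num
  have hexp : Real.exp (-(2 * k + 1) * y) = Real.exp (-y) * Real.exp (-(2 * y)) ^ k := by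
    rw [← Real.exp_nat_mul, ← Real.exp_add]
    ring_nf
  have hgauss : ∀ x : ℝ, Real.exp (-(x ^ 2 / 2)) =
      Real.exp (x ^ 2 / 2) * Real.exp (-((√2 * x) ^ 2 / 2)) := fun x => by
    rw [← Real.exp_add, mul_pow, Real.sq_sqrt zero_le_two]
    ring_nf
  rw [eigenfunction_apply, eigenfunction_apply, ← ofReal_mul, ← ofReal_mul, hexp, hgauss x,
    hgauss x', ← hpi, add_div, Real.exp_add,
    div_eq_mul_inv (Real.exp (-(2 * y)) ^ k), ← hfactorial]
  congr 1
  ring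

theorem integral_cexp_mul_heatKernel {y : ℝ} (hy : 0 < y) (p q : ℝ) :
    ∫ x : ℝ, exp (p * x * I) * heatKernel y x (x - q) =
      exp (p * q / 2 * I) *
        ((2 * Real.sinh y)⁻¹ * Real.exp (-((p ^ 2 + q ^ 2) / (4 * Real.tanh y))) : ℝ) := by
  have htanh := tanh_pos hy
  have hexponent : ∀ x : ℝ, exp (p * x * I) * heatKernel y x (x - q) =
      ((√(2 * Real.pi * Real.sinh (2 * y)))⁻¹ : ℝ) *
        exp ((-Real.tanh y : ℝ) * x ^ 2 + (Real.tanh y * q + p * I) * x +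
          (-(Real.tanh y * q ^ 2 / 4) - q ^ 2 / (4 * Real.tanh y))) := by
    intro x
    rw [heatKernel, ofReal_mul, mul_left_comm, ofReal_exp, ← exp_add]
    push_cast
    ring_nf
  have hconst : ((√(2 * Real.pi * Real.sinh (2 * y)))⁻¹ : ℝ) *
      (Real.pi / -((-Real.tanh y : ℝ) : ℂ)) ^ (1 / 2 : ℂ) = ((2 * Real.sinh y)⁻¹ : ℝ) := by
    rw [← ofReal_neg, neg_neg, ← ofReal_div, show (1 / 2 : ℂ) = ((1 / 2 : ℝ) : ℂ) by norm_num,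
      ← ofReal_cpow (by positivity), ← Real.sqrt_eq_rpow, ← ofReal_mul, ← Real.sqrt_inv,
      ← Real.sqrt_mul' _ (by positivity),
      ← Real.sqrt_sq (by positivity : 0 ≤ (2 * Real.sinh y)⁻¹)]
    congr 2
    rw [Real.sinh_two_mul, Real.tanh_eq_sinh_div_cosh]
    have := Real.cosh_pos y
    field_simp
  simp only [hexponent]
  rw [integral_const_mul, integral_cexp_quadratic (by rw [ofReal_re]; linarith), ← mul_assoc,
    hconst, ofReal_mul, mul_left_comm, ofReal_exp, ← exp_add]
  have htanh' : (Real.tanh y : ℂ) ≠ 0 := mod_cast htanh.ne'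
  congr 2
  push_cast at htanh' ⊢
  field_simp
  linear_combination 2 * p ^ 2 * I_sq

theorem integral_heatKernel {y : ℝ} (hy : 0 < y) (q : ℝ) :
    ∫ x, heatKernel y x (x - q) =
      (2 * Real.sinh y)⁻¹ * Real.exp (-(q ^ 2 / (4 * Real.tanh y))) := by
  have h := integral_cexp_mul_heatKernel hy 0 q
  simp only [ofReal_zero, zero_mul, zero_div, exp_zero, one_mul, zero_pow two_ne_zero, zero_add,
    integral_complex_ofReal] at h
  exact_mod_cast h

theorem integrable_heatKernel {y : ℝ} (hy : 0 < y) (q : ℝ) :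
    Integrable fun x => heatKernel y x (x - q) := by
  refine .of_integral_ne_zero ?_
  rw [integral_heatKernel hy]
  have := Real.sinh_pos_iff.mpr hy
  positivity

/-! ### Normalisation of the eigenfunctions -/

theorem conj_eigenfunction (k : ℕ) (x : ℝ) :
    (starRingEnd ℂ) (eigenfunction k x) = eigenfunction k x := by
  rw [eigenfunction_apply, conj_ofReal]

theorem integrable_schwartz_mul (f g : 𝓢(ℝ, ℂ)) : Integrable fun x => f x * g x :=
  (f.memLp 2 volume).integrable_mul (g.memLp 2 volume)

theorem integral_creation_mul (f g : 𝓢(ℝ, ℂ)) :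
    ∫ x, creation f x * g x = ∫ x, f x * (position g + ddx g) x := by
  have hleft : ∀ x, creation f x * g x = f x * position g x - ddx f x * g x := by
    intro x
    rw [creation, sub_apply, sub_apply, position_apply, position_apply]
    ring
  simp only [hleft, add_apply, mul_add]
  rw [integral_sub (integrable_schwartz_mul _ _) (integrable_schwartz_mul _ _),
    integral_add (integrable_schwartz_mul _ _) (integrable_schwartz_mul _ _), sub_eq_add_neg]
  exact congrArg _ (SchwartzMap.integral_mul_deriv_eq_neg_deriv_mul f g).symm

theorem annihilation_creation (f : 𝓢(ℝ, ℂ)) :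
    position (creation f) + ddx (creation f) = oscillator f + f := by
  change position (position f - ddx f) + ddx (position f - ddx f) =
    (-ddx (ddx f) + position (position f)) + f
  simp only [map_sub, ddx_position]
  abel

theorem integral_eigenfunction_zero_sq : ∫ x, eigenfunction 0 x * eigenfunction 0 x = 1 := by
  have hsq : ∀ x, eigenfunction 0 x * eigenfunction 0 x =
      (((√Real.pi)⁻¹ * Real.exp (-1 * x ^ 2) : ℝ) : ℂ) := by
    intro x
    have hpi : (√Real.pi)⁻¹ = Real.pi ^ (-(1 / 4) : ℝ) * Real.pi ^ (-(1 / 4) : ℝ) := by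
      rw [← Real.rpow_add Real.pi_pos, Real.sqrt_eq_rpow, ← Real.rpow_neg Real.pi_pos.le]
      norm_num
    have hexp : Real.exp (-1 * x ^ 2) = Real.exp (-(x ^ 2 / 2)) * Real.exp (-(x ^ 2 / 2)) := by
      rw [← Real.exp_add]
      ring_nf
    rw [eigenfunction_apply, ← ofReal_mul, hpi, hexp]
    simp only [Polynomial.hermite_zero, Nat.factorial_zero, Nat.cast_one, Real.one_rpow, map_one,
      one_mul, mul_one]
    ring_nf
  simp only [hsq]
  rw [integral_complex_ofReal, integral_const_mul, integral_gaussian, div_one,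
    inv_mul_cancel₀ (Real.sqrt_ne_zero'.mpr Real.pi_pos), ofReal_one]

theorem integral_eigenfunction_sq (k : ℕ) : ∫ x, eigenfunction k x * eigenfunction k x = 1 := by
  induction k with
  | zero => exact integral_eigenfunction_zero_sq
  | succ k ih =>
    set c : ℝ := (2 * ((k : ℝ) + 1)) ^ (-(1 / 2) : ℝ) with hc
    have hcc : c * c * (2 * (k + 1)) = 1 := by
      rw [hc, ← Real.rpow_add (by positivity), ← Real.rpow_add_one (by positivity)]
      norm_num
    have hnumber : position (creation (eigenfunction k)) + ddx (creation (eigenfunction k)) =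
        (2 * (k + 1) : ℂ) • eigenfunction k := by
      rw [annihilation_creation, oscillator_eigenfunction]
      module
    calc ∫ x, eigenfunction (k + 1) x * eigenfunction (k + 1) x
        = ∫ x, (c * c : ℂ) * (creation (eigenfunction k) x * creation (eigenfunction k) x) := by
          congr with x
          rw [eigenfunction, smul_apply, smul_eq_mul]
          ring
      _ = c * c * ∫ x, (2 * (k + 1) : ℂ) * (eigenfunction k x * eigenfunction k x) := by
          rw [integral_const_mul, integral_creation_mul, hnumber]
          congr with x
          rw [smul_apply, smul_eq_mul, mul_left_comm]
      _ = 1 := by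
          rw [integral_const_mul, ih, mul_one]
          exact_mod_cast hcc

theorem inner_eigenvector_self (k : ℕ) : inner ℂ (eigenvector k) (eigenvector k) = (1 : ℂ) := by
  rw [eigenvector, SchwartzMap.inner_toL2_toL2_eq _ _ volume, ← integral_eigenfunction_sq k]
  congr with x
  rw [RCLike.inner_apply, conj_eigenfunction]

theorem norm_eigenvector (k : ℕ) : ‖eigenvector k‖ = 1 := by
  rw [@norm_eq_sqrt_re_inner ℂ, inner_eigenvector_self k, RCLike.one_re, Real.sqrt_one]

/-! ### The heat trace -/

/-- The functional `T ↦ ⟨ξ, T ξ⟩`. -/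
def vectorFunctional (𝕜 : Type*) {E : Type*} [RCLike 𝕜] [NormedAddCommGroup E]
    [InnerProductSpace 𝕜 E] (ξ : E) : (E →L[𝕜] E) →L[𝕜] 𝕜 :=
  innerSL 𝕜 ξ ∘L ContinuousLinearMap.apply 𝕜 E ξ

section VectorFunctional

variable {𝕜 E : Type*} [RCLike 𝕜] [NormedAddCommGroup E] [InnerProductSpace 𝕜 E]

theorem vectorFunctional_apply (ξ : E) (T : E →L[𝕜] E) :
    vectorFunctional 𝕜 ξ T = inner 𝕜 ξ (T ξ) :=
  rfl

theorem norm_vectorFunctional_le (ξ : E) : ‖vectorFunctional 𝕜 ξ‖ ≤ ‖ξ‖ ^ 2 := by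
  refine ContinuousLinearMap.opNorm_le_bound _ (by positivity) fun T => ?_
  calc ‖inner 𝕜 ξ (T ξ)‖ ≤ ‖ξ‖ * ‖T ξ‖ := norm_inner_le_norm _ _
    _ ≤ ‖ξ‖ * (‖T‖ * ‖ξ‖) := by gcongr; exact T.le_opNorm ξ
    _ = ‖ξ‖ ^ 2 * ‖T‖ := by ring

end VectorFunctional

theorem norm_vectorFunctional_eigenvector_le (k : ℕ) :
    ‖vectorFunctional ℂ (eigenvector k)‖ ≤ 1 := by
  simpa only [norm_eigenvector, one_pow] using norm_vectorFunctional_le (𝕜 := ℂ) (eigenvector k)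

theorem summable_exp_odd_mul {y : ℝ} (hy : 0 < y) :
    Summable fun k : ℕ => Real.exp (-(2 * k + 1) * y) := by
  have h := (Real.summable_exp_nat_mul_of_ge (c := -(2 * y)) (by linarith)
    (f := fun k => k) fun k => le_rfl).mul_left (Real.exp (-y))
  refine h.congr fun k => ?_
  rw [← Real.exp_add]
  ring_nf

/-- The heat trace `T ↦ Tr (T e^{-yH})` for `y > 0`, as a functional on all bounded operators. For
`y ≤ 0` the series diverges and this is `0`. -/
def heatTrace (y : ℝ) : Op →L[ℂ] ℂ :=
  ∑' k : ℕ, (Real.exp (-(2 * k + 1) * y) : ℂ) • vectorFunctional ℂ (eigenvector k)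

theorem hasSum_heatTrace {y : ℝ} (hy : 0 < y) (T : Op) :
    HasSum (fun k : ℕ => (Real.exp (-(2 * k + 1) * y) : ℂ) *
        vectorFunctional ℂ (eigenvector k) T) (heatTrace y T) := by
  have hsum : Summable fun k : ℕ =>
      (Real.exp (-(2 * k + 1) * y) : ℂ) • vectorFunctional ℂ (eigenvector k) := by
    refine .of_norm_bounded (summable_exp_odd_mul hy) fun k => ?_
    rw [norm_smul, norm_real, Real.norm_of_nonneg (Real.exp_pos _).le]
    exact mul_le_of_le_one_right (Real.exp_pos _).le (norm_vectorFunctional_eigenvector_le k)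
  exact hsum.hasSum.mapL (ContinuousLinearMap.apply ℂ ℂ T)

theorem vectorFunctional_eigenvector_mulOp_mul_translation {g : ℝ → ℂ}
    (hg : MemLp g ∞ volume) (q : ℝ) (k : ℕ) :
    vectorFunctional ℂ (eigenvector k)
        (mulOp g hg * ((translation q).toContinuousLinearEquiv : Op)) =
      ∫ x, g x * (eigenfunction k x * eigenfunction k (x - q)) := by
  have hψ : eigenvector k =ᵐ[volume] eigenfunction k := (eigenfunction k).coeFn_toLp 2 volume
  have hψq := (measurePreserving_sub_right (volume : Measure ℝ) q).quasiMeasurePreserving.ae hψ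
  change inner ℂ (eigenvector k) (mulOp g hg (translation q (eigenvector k))) = _
  rw [L2.inner_def]
  refine integral_congr_ae ?_
  filter_upwards [coeFn_mulOp g hg (translation q (eigenvector k)),
    coeFn_translation q (eigenvector k), hψ, hψq] with x hmul htrans hx hxq
  rw [hmul, htrans, hx, hxq, RCLike.inner_apply, conj_eigenfunction, mul_assoc,
    mul_comm (eigenfunction k (x - q))]

theorem hasSum_norm_eigenfunction_sq {y : ℝ} (hy : 0 < y) (x : ℝ) :
    HasSum (fun k : ℕ => Real.exp (-(2 * k + 1) * y) * ‖eigenfunction k x‖ ^ 2)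
      (heatKernel y x x) := by
  rw [← hasSum_ofReal]
  refine (hasSum_eigenfunction_mul_eigenfunction hy x x).congr_fun fun k => ?_
  rw [ofReal_mul, ofReal_pow, ← conj_mul', conj_eigenfunction]

/-- The operator `g U_q e^{-yH}` has the integral kernel `g x * heatKernel y (x - q) x'`. -/
theorem heatTrace_mulOp_mul_translation {y : ℝ} (hy : 0 < y) {g : ℝ → ℂ}
    (hg : MemLp g ∞ volume) (q : ℝ) :
    heatTrace y (mulOp g hg * ((translation q).toContinuousLinearEquiv : Op)) =
      ∫ x, g x * heatKernel y x (x - q) := by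
  have htrace := hasSum_heatTrace hy (mulOp g hg * ((translation q).toContinuousLinearEquiv : Op))
  simp only [vectorFunctional_eigenvector_mulOp_mul_translation, ← integral_const_mul] at htrace
  have hdiag : Integrable fun x => heatKernel y x x := by
    simpa only [sub_zero] using integrable_heatKernel hy 0
  have hbound : ∀ x, HasSum (fun k : ℕ => lpNorm g ∞ volume / 2 *
      (Real.exp (-(2 * k + 1) * y) * ‖eigenfunction k x‖ ^ 2 +
        Real.exp (-(2 * k + 1) * y) * ‖eigenfunction k (x - q)‖ ^ 2))
      (lpNorm g ∞ volume / 2 * (heatKernel y x x + heatKernel y (x - q) (x - q))) := fun x =>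
    ((hasSum_norm_eigenfunction_sq hy x).add
      (hasSum_norm_eigenfunction_sq hy (x - q))).mul_left _
  refine htrace.unique (hasSum_integral_of_dominated_convergence _ (fun k => ?_) (fun k => ?_)
    (.of_forall fun x => (hbound x).summable) ?_ (.of_forall fun x => ?_))
  · have := (eigenfunction k).continuous
    exact (hg.1.mul (by fun_prop)).const_mul _
  · filter_upwards [ae_le_lpNorm_exponent_top hg] with x hx
    rw [norm_mul, norm_mul, norm_mul, norm_real, Real.norm_of_nonneg (Real.exp_pos _).le]
    have hamgm := two_mul_le_add_sq ‖eigenfunction k x‖ ‖eigenfunction k (x - q)‖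
    calc _ ≤ Real.exp (-(2 * k + 1) * y) * (lpNorm g ∞ volume *
          ((‖eigenfunction k x‖ ^ 2 + ‖eigenfunction k (x - q)‖ ^ 2) / 2)) := by
          gcongr
          · exact (norm_nonneg _).trans hx
          · linarith
      _ = _ := by ring
  · simp only [fun x => (hbound x).tsum_eq]
    exact (hdiag.add (hdiag.comp_sub_right q)).const_mul _
  · refine ((hasSum_eigenfunction_mul_eigenfunction hy x (x - q)).mul_left (g x)).congr_fun
      fun k => ?_
    ring

theorem norm_heatTrace_mulOp_mul_translation_le {y : ℝ} (hy : 0 < y) {g : ℝ → ℂ}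
    (hg : MemLp g ∞ volume) (q : ℝ) :
    ‖heatTrace y (mulOp g hg * ((translation q).toContinuousLinearEquiv : Op))‖ ≤
      lpNorm g ∞ volume *
        ((2 * Real.sinh y)⁻¹ * Real.exp (-(q ^ 2 / (4 * Real.tanh y)))) := by
  rw [heatTrace_mulOp_mul_translation hy, ← integral_heatKernel hy, ← integral_const_mul]
  refine norm_integral_le_of_norm_le ((integrable_heatKernel hy q).const_mul _) ?_
  filter_upwards [ae_le_lpNorm_exponent_top hg] with x hx
  rw [norm_mul, norm_real, Real.norm_of_nonneg (heatKernel_nonneg _ _ _)]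
  exact mul_le_mul_of_nonneg_right hx (heatKernel_nonneg _ _ _)

/-! ### Traces of nuclear operators -/

section NuclearOperators

variable {𝕜 E ι κ : Type*} [RCLike 𝕜] [NormedAddCommGroup E] [InnerProductSpace 𝕜 E]

theorem sum_norm_inner_mul_inner_le {e : ι → E} (he : Orthonormal 𝕜 e) (x y : E) (s : Finset ι) :
    ∑ i ∈ s, ‖inner 𝕜 y (e i) * inner 𝕜 (e i) x‖ ≤ ‖x‖ * ‖y‖ := by
  simp only [norm_mul, norm_inner_symm y]
  refine le_of_sq_le_sq ?_ (by positivity)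
  calc (∑ i ∈ s, ‖inner 𝕜 (e i) y‖ * ‖inner 𝕜 (e i) x‖) ^ 2
      ≤ (∑ i ∈ s, ‖inner 𝕜 (e i) y‖ ^ 2) * ∑ i ∈ s, ‖inner 𝕜 (e i) x‖ ^ 2 :=
        Finset.sum_mul_sq_le_sq_mul_sq _ _ _
    _ ≤ ‖y‖ ^ 2 * ‖x‖ ^ 2 := by
        gcongr
        · exact he.sum_inner_products_le y
        · exact he.sum_inner_products_le x
    _ = (‖x‖ * ‖y‖) ^ 2 := by ring

theorem summable_inner_mul_inner_prod {e : ι → E} (he : Orthonormal 𝕜 e) {x y : κ → E}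
    (hxy : Summable fun n => ‖x n‖ * ‖y n‖) :
    Summable fun p : κ × ι => inner 𝕜 (y p.1) (e p.2) * inner 𝕜 (e p.2) (x p.1) := by
  have hle := fun n => sum_norm_inner_mul_inner_le he (x n) (y n)
  refine .of_norm ((summable_prod_of_nonneg fun p => norm_nonneg _).mpr
    ⟨fun n => summable_of_sum_le (fun _ => norm_nonneg _) (hle n), ?_⟩)
  exact .of_nonneg_of_le (fun n => tsum_nonneg fun _ => norm_nonneg _)
    (fun n => Real.tsum_le_of_sum_le (fun _ => norm_nonneg _) (hle n)) hxy

theorem vectorFunctional_rankOne (ξ x y : E) :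
    vectorFunctional 𝕜 ξ (InnerProductSpace.rankOne 𝕜 x y) = inner 𝕜 y ξ * inner 𝕜 ξ x :=
  inner_smul_right _ _ _

theorem hasSum_vectorFunctional_of_hasSum_rankOne (e : HilbertBasis ι 𝕜 E) {x y : κ → E}
    {T : E →L[𝕜] E} {c : 𝕜} (hxy : Summable fun n => ‖x n‖ * ‖y n‖)
    (hT : HasSum (fun n => InnerProductSpace.rankOne 𝕜 (x n) (y n)) T)
    (hc : HasSum (fun n => inner 𝕜 (y n) (x n)) c) :
    HasSum (fun i => vectorFunctional 𝕜 (e i) T) c := by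
  have hprod := (summable_inner_mul_inner_prod e.orthonormal hxy).hasSum
  have hsum_basis := hprod.prod_fiberwise fun n => e.hasSum_inner_mul_inner (y n) (x n)
  rw [hsum_basis.unique hc] at hprod
  refine ((Equiv.prodComm ι κ).hasSum_iff.mpr hprod).prod_fiberwise fun i => ?_
  refine (hT.mapL (vectorFunctional 𝕜 (e i))).congr_fun fun n => ?_
  exact (vectorFunctional_rankOne _ _ _).symm

end NuclearOperators

theorem norm_two_mul_add_one_cpow (k : ℕ) (s : ℂ) :
    ‖(2 * (k : ℂ) + 1) ^ (-s)‖ = 1 / (2 * (k : ℝ) + 1) ^ s.re := by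
  have h := norm_cpow_eq_rpow_re_of_pos (x := 2 * k + 1) (by positivity) (-s)
  push_cast at h
  rw [h, neg_re, Real.rpow_neg (by positivity), one_div]

theorem summable_one_div_two_mul_add_one_rpow {σ : ℝ} (hσ : 1 < σ) :
    Summable fun k : ℕ => 1 / (2 * (k : ℝ) + 1) ^ σ := by
  have h := (Real.summable_one_div_nat_rpow.mpr hσ).comp_injective
    (i := fun k : ℕ => 2 * k + 1) (fun a b h => by simpa using h)
  exact_mod_cast h

theorem hasSum_oscillatorPow {s : ℂ} (hs : 1 < s.re) :
    HasSum (fun k : ℕ => (2 * (k : ℂ) + 1) ^ (-s) •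
      InnerProductSpace.rankOne ℂ (eigenvector k) (eigenvector k)) (oscillatorPow s) := by
  refine (Summable.of_norm ((summable_one_div_two_mul_add_one_rpow hs).congr fun k => ?_)).hasSum
  rw [norm_smul, InnerProductSpace.norm_rankOne, norm_eigenvector, norm_two_mul_add_one_cpow,
    mul_one, mul_one]

theorem hasSum_mul_oscillatorPow (T : Op) {s : ℂ} (hs : 1 < s.re) :
    HasSum (fun k : ℕ => InnerProductSpace.rankOne ℂ ((2 * (k : ℂ) + 1) ^ (-s) • T (eigenvector k))
      (eigenvector k)) (T * oscillatorPow s) := by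
  refine ((hasSum_oscillatorPow hs).mul_left T).congr_fun fun k => ?_
  rw [mul_smul_comm, ContinuousLinearMap.mul_def, InnerProductSpace.comp_rankOne, map_smul,
    smul_apply]

theorem hasTrace_mul_oscillatorPow (T : Op) {s c : ℂ} (hs : 1 < s.re)
    (hc : HasSum (fun k : ℕ =>
      (2 * (k : ℂ) + 1) ^ (-s) * vectorFunctional ℂ (eigenvector k) T) c) :
    HasTrace (T * oscillatorPow s) c := by
  have hnorm : Summable fun k : ℕ =>
      ‖(2 * (k : ℂ) + 1) ^ (-s) • T (eigenvector k)‖ * ‖eigenvector k‖ := by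
    refine .of_nonneg_of_le (fun k => by positivity) (fun k => ?_)
      ((summable_one_div_two_mul_add_one_rpow hs).mul_right ‖T‖)
    rw [norm_smul, norm_eigenvector, norm_two_mul_add_one_cpow, mul_one]
    gcongr
    simpa only [norm_eigenvector, mul_one] using T.le_opNorm (eigenvector k)
  have hrank := hasSum_mul_oscillatorPow T hs
  have hinner : HasSum (fun k : ℕ =>
      inner ℂ (eigenvector k) ((2 * (k : ℂ) + 1) ^ (-s) • T (eigenvector k))) c := by
    simpa only [inner_smul_right, vectorFunctional_apply] using hc
  refine ⟨⟨_, _, hnorm, hrank⟩, fun ι e => ?_⟩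
  have h := hasSum_vectorFunctional_of_hasSum_rankOne e hnorm hrank hinner
  simpa only [vectorFunctional_apply] using h

/-! ### Spectral zeta functions -/

/-- `F` agrees with the spectral zeta function `s ↦ Tr (T H^{-s})` on the half-plane `Re s > 1`, the
trace being computed in the basis of eigenvectors of `H`. -/
def IsSpectralZeta (T : Op) (F : ℂ → ℂ) : Prop :=
  ∀ s : ℂ, 1 < s.re → HasSum (fun k : ℕ =>
    (2 * (k : ℂ) + 1) ^ (-s) * vectorFunctional ℂ (eigenvector k) T) (F s)

theorem IsSpectralZeta.hasTrace {T : Op} {F : ℂ → ℂ} (hF : IsSpectralZeta T F) {s : ℂ}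
    (hs : 1 < s.re) : HasTrace (T * oscillatorPow s) (F s) :=
  hasTrace_mul_oscillatorPow T hs (hF s hs)

theorem IsSpectralZeta.add {S T : Op} {F G : ℂ → ℂ} (hF : IsSpectralZeta S F)
    (hG : IsSpectralZeta T G) : IsSpectralZeta (S + T) (F + G) := fun s hs =>
  ((hF s hs).add (hG s hs)).congr_fun fun k => by rw [map_add, mul_add]

theorem IsSpectralZeta.const_smul {T : Op} {F : ℂ → ℂ} (c : ℂ) (hF : IsSpectralZeta T F) :
    IsSpectralZeta (c • T) (c • F) := fun s hs =>
  ((hF s hs).mul_left c).congr_fun fun k => by rw [map_smul, smul_eq_mul, mul_left_comm]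

/-- The Hurwitz zeta function enters through `(2k + 1)^{-s} = 2^{-s} (k + 1/2)^{-s}`. -/
theorem isSpectralZeta_one :
    IsSpectralZeta 1 fun s =>
      2 ^ (-s) * HurwitzZeta.hurwitzZeta ((1 / 2 : ℝ) : UnitAddCircle) s := by
  intro s hs
  have hhurwitz := HurwitzZeta.hasSum_hurwitzZeta_of_one_lt_re
    (a := 1 / 2) ⟨by norm_num, by norm_num⟩ hs
  refine (hhurwitz.mul_left (2 ^ (-s))).congr_fun fun k => ?_
  have hunit : vectorFunctional ℂ (eigenvector k) 1 = 1 := inner_eigenvector_self k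
  have hsplit : 2 * (k : ℂ) + 1 = ((2 : ℝ) : ℂ) * ((k + 1 / 2 : ℝ) : ℂ) := by push_cast; ring
  rw [hunit, mul_one, hsplit, mul_cpow_ofReal_nonneg zero_le_two (by positivity), one_div]
  push_cast
  simp only [cpow_neg, one_div]

theorem tanh_le_self {y : ℝ} (hy : 0 ≤ y) : Real.tanh y ≤ y := by
  rw [Real.tanh_eq_sinh_div_cosh, div_le_iff₀ (Real.cosh_pos y)]
  have hmvt := (convex_Icc 0 y).image_sub_le_mul_sub_of_deriv_le (f := Real.sinh)
    (C := Real.cosh y) Real.continuous_sinh.continuousOn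
    Real.differentiable_sinh.differentiableOn (fun x hx => ?_) 0 ⟨le_rfl, hy⟩ y ⟨hy, le_rfl⟩ hy
  · simpa only [Real.sinh_zero, sub_zero, mul_comm (Real.cosh y)] using hmvt
  · obtain ⟨hx0, hxy⟩ := interior_subset hx
    rwa [Real.deriv_sinh, Real.cosh_le_cosh, abs_of_nonneg hx0, abs_of_nonneg hy]

theorem inv_mul_exp_neg_div_le {r z : ℝ} (hr : 0 < r) (hz : 0 < z) (N : ℕ) :
    z⁻¹ * Real.exp (-(r / z)) ≤ (N + 1).factorial / r ^ (N + 1) * z ^ N := by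
  have h := Real.pow_div_factorial_le_exp (r / z) (by positivity) (N + 1)
  rw [Real.exp_neg, ← mul_inv, inv_le_comm₀ (by positivity) (by positivity)]
  calc ((N + 1).factorial / r ^ (N + 1) * z ^ N)⁻¹
      = z * ((r / z) ^ (N + 1) / (N + 1).factorial) := by
        rw [div_pow, pow_succ z]
        field_simp
    _ ≤ z * Real.exp (r / z) := by gcongr

theorem inv_two_mul_cosh_le_exp_neg (y : ℝ) : (2 * Real.cosh y)⁻¹ ≤ Real.exp (-y) := by
  rw [Real.exp_neg, Real.cosh_eq, mul_div_cancel₀ _ two_ne_zero]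
  gcongr
  exact le_add_of_nonneg_right (Real.exp_pos _).le

theorem inv_two_mul_sinh_mul_exp_neg_div_tanh_le {r y : ℝ} (hr : 0 < r) (hy : 0 < y) (N : ℕ) :
    (2 * Real.sinh y)⁻¹ * Real.exp (-(r / Real.tanh y)) ≤
      (N + 1).factorial / r ^ (N + 1) * (y ^ N * Real.exp (-y)) := by
  have htanh := tanh_pos hy
  have hsinh : Real.sinh y = Real.tanh y * Real.cosh y := by
    rw [Real.tanh_eq_sinh_div_cosh, div_mul_cancel₀ _ (Real.cosh_pos y).ne']
  calc (2 * Real.sinh y)⁻¹ * Real.exp (-(r / Real.tanh y))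
      = (Real.tanh y)⁻¹ * Real.exp (-(r / Real.tanh y)) * (2 * Real.cosh y)⁻¹ := by
        rw [hsinh, mul_left_comm, mul_inv, mul_right_comm]
    _ ≤ (N + 1).factorial / r ^ (N + 1) * Real.tanh y ^ N * Real.exp (-y) := by
        exact mul_le_mul (inv_mul_exp_neg_div_le hr htanh N) (inv_two_mul_cosh_le_exp_neg y)
          (by have := Real.cosh_pos y; positivity) (by positivity)
    _ ≤ (N + 1).factorial / r ^ (N + 1) * y ^ N * Real.exp (-y) := by
        gcongr
        exact tanh_le_self hy.le
    _ = _ := mul_assoc _ _ _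

/-- Besides the exponential decay at infinity, `f` is assumed to vanish to infinite order at `0`,
so that no pole appears in the Mellin transform. -/
theorem differentiable_mellin_of_norm_le {E : Type*} [NormedAddCommGroup E] [NormedSpace ℂ E]
    {f : ℝ → E} (hf : AEStronglyMeasurable f (volume.restrict (Set.Ioi 0))) {C : ℕ → ℝ}
    (hbound : ∀ N : ℕ, ∀ y : ℝ, 0 < y → ‖f y‖ ≤ C N * (y ^ N * Real.exp (-y))) :
    Differentiable ℂ (mellin f) := by
  have hC (N : ℕ) : 0 ≤ C N :=
    nonneg_of_mul_nonneg_left ((norm_nonneg _).trans (hbound N 1 one_pos)) (by positivity)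
  have hdecay : ∀ y : ℝ, 0 < y → ‖f y‖ ≤ C 0 * Real.exp (-y) := by
    simpa only [pow_zero, one_mul] using hbound 0
  have hintegrable : IntegrableOn f (Set.Ioi 0) :=
    ((exp_neg_integrableOn_Ioi 0 one_pos).const_mul (C 0)).mono' hf <| by
      filter_upwards [ae_restrict_mem measurableSet_Ioi] with y hy
      simpa only [neg_mul, one_mul] using hdecay y hy
  have htop : f =O[atTop] fun y => Real.exp (-1 * y) := by
    refine .of_bound (C 0) ?_
    filter_upwards [eventually_gt_atTop 0] with y hy
    rw [Real.norm_of_nonneg (Real.exp_pos _).le, neg_one_mul]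
    exact hdecay y hy
  have hbot (N : ℕ) : f =O[𝓝[>] 0] fun y => y ^ (-(-(N : ℝ))) := by
    refine .of_bound (C N) ?_
    filter_upwards [self_mem_nhdsWithin] with y (hy : 0 < y)
    rw [neg_neg, Real.rpow_natCast, Real.norm_of_nonneg (by positivity)]
    refine (hbound N y hy).trans (mul_le_mul_of_nonneg_left ?_ (hC N))
    exact mul_le_of_le_one_right (by positivity) (Real.exp_le_one_iff.mpr (by linarith))
  intro s
  obtain ⟨N, hN⟩ := exists_nat_gt (-s.re)
  exact mellin_differentiableAt_of_isBigO_rpow_exp one_pos hintegrable.locallyIntegrableOn htop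
    (hbot N) (by linarith)

theorem aestronglyMeasurable_heatTrace (T : Op) :
    AEStronglyMeasurable (fun y => heatTrace y T) (volume.restrict (Set.Ioi 0)) := by
  refine aestronglyMeasurable_of_tendsto_ae (f := fun s : Finset ℕ => fun y : ℝ => ∑ k ∈ s,
    (Real.exp (-(2 * k + 1) * y) : ℂ) * vectorFunctional ℂ (eigenvector k) T) atTop
    (fun s => by fun_prop) ?_
  filter_upwards [ae_restrict_mem measurableSet_Ioi] with y hy
  exact hasSum_heatTrace hy T

theorem isSpectralZeta_mellin_heatTrace (T : Op) :
    IsSpectralZeta T fun s => (Gamma s)⁻¹ * mellin (fun y => heatTrace y T) s := by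
  intro s hs
  have hpos : 0 < s.re := by linarith
  have hcoeff (k : ℕ) : ‖vectorFunctional ℂ (eigenvector k) T‖ ≤ ‖T‖ := by
    simpa only [one_mul] using (vectorFunctional ℂ (eigenvector k)).le_of_opNorm_le
      (norm_vectorFunctional_eigenvector_le k) T
  have hsummable : Summable fun k : ℕ =>
      ‖vectorFunctional ℂ (eigenvector k) T‖ / (2 * (k : ℝ) + 1) ^ s.re := by
    refine .of_nonneg_of_le (fun k => by positivity) (fun k => ?_)
      ((summable_one_div_two_mul_add_one_rpow hs).mul_left ‖T‖)
    rw [mul_one_div]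
    gcongr
    exact hcoeff k
  have hmellin := hasSum_mellin (a := fun k => vectorFunctional ℂ (eigenvector k) T)
    (p := fun k : ℕ => 2 * (k : ℝ) + 1) (F := fun y => heatTrace y T)
    (fun k => .inr (by positivity)) hpos
    (fun y hy => (hasSum_heatTrace hy T).congr_fun fun k => mul_comm _ _) hsummable
  refine (hmellin.mul_left (Gamma s)⁻¹).congr_fun fun k => ?_
  have hGamma := Gamma_ne_zero_of_re_pos hpos
  rw [cpow_neg]
  push_cast
  field_simp

theorem exists_entire_isSpectralZeta {T : Op} {C r : ℝ} (hr : 0 < r)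
    (hT : ∀ y : ℝ, 0 < y → ‖heatTrace y T‖ ≤
      C * ((2 * Real.sinh y)⁻¹ * Real.exp (-(r / Real.tanh y)))) :
    ∃ F : ℂ → ℂ, Differentiable ℂ F ∧ IsSpectralZeta T F := by
  have hC : 0 ≤ C :=
    nonneg_of_mul_nonneg_left ((norm_nonneg _).trans (hT 1 one_pos)) <|
      mul_pos (inv_pos.mpr (mul_pos two_pos (Real.sinh_pos_iff.mpr one_pos))) (Real.exp_pos _)
  refine ⟨_, differentiable_one_div_Gamma.mul (differentiable_mellin_of_norm_le
    (C := fun N => C * ((N + 1).factorial / r ^ (N + 1))) (aestronglyMeasurable_heatTrace T)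
    fun N y hy => ?_), isSpectralZeta_mellin_heatTrace T⟩
  rw [mul_assoc]
  exact (hT y hy).trans
    (mul_le_mul_of_nonneg_left (inv_two_mul_sinh_mul_exp_neg_div_tanh_le hr hy N) hC)

/-! ### Simple poles -/

section SimplePole

variable {F : ℂ → ℂ} {z₀ R : ℂ}

theorem meromorphicAt_of_tendsto_sub_mul (hF : ∀ z, z ≠ z₀ → DifferentiableAt ℂ F z)
    (hR : Tendsto (fun z => (z - z₀) * F z) (𝓝[≠] z₀) (𝓝 R)) : MeromorphicAt F z₀ := by
  have hanalytic : AnalyticAt ℂ (Function.update (fun z => (z - z₀) * F z) z₀ R) z₀ := by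
    refine analyticAt_of_differentiable_on_punctured_nhds_of_continuousAt ?_
      (continuousAt_update_same.mpr hR)
    filter_upwards [self_mem_nhdsWithin] with z hz
    refine DifferentiableAt.congr_of_eventuallyEq
      ((differentiableAt_id.sub_const z₀).mul (hF z hz)) ?_
    filter_upwards [isOpen_ne.mem_nhds hz] with w hw
    exact Function.update_of_ne hw _ _
  have hinv : MeromorphicAt (fun z => (z - z₀)⁻¹) z₀ := by fun_prop
  refine (hinv.mul hanalytic.meromorphicAt).congr ?_
  filter_upwards [self_mem_nhdsWithin] with z hz
  rw [Pi.mul_apply, Function.update_of_ne hz, inv_mul_cancel_left₀ (sub_ne_zero.mpr hz)]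

theorem meromorphicOn_univ_of_tendsto_sub_mul (hF : ∀ z, z ≠ z₀ → DifferentiableAt ℂ F z)
    (hR : Tendsto (fun z => (z - z₀) * F z) (𝓝[≠] z₀) (𝓝 R)) : MeromorphicOn F Set.univ := by
  intro z _
  obtain rfl | hz := eq_or_ne z z₀
  · exact meromorphicAt_of_tendsto_sub_mul hF hR
  · refine (DifferentiableOn.analyticAt (s := {z₀}ᶜ) (fun w hw => ?_)
      (isOpen_ne.mem_nhds hz)).meromorphicAt
    exact (hF w hw).differentiableWithinAt

theorem neg_one_le_meromorphicOrderAt_of_tendsto_sub_mul (hF : MeromorphicAt F z₀)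
    (hR : Tendsto (fun z => (z - z₀) * F z) (𝓝[≠] z₀) (𝓝 R)) :
    ((-1 : ℤ) : WithTop ℤ) ≤ meromorphicOrderAt F z₀ := by
  have hsub : MeromorphicAt (· - z₀) z₀ := by fun_prop
  have hnonneg := (tendsto_nhds_iff_meromorphicOrderAt_nonneg (hsub.mul hF)).mp ⟨R, hR⟩
  rw [meromorphicOrderAt_mul hsub hF, meromorphicOrderAt_id_sub_const] at hnonneg
  cases hn : meromorphicOrderAt F z₀ with
  | top => exact le_top
  | coe n =>
    rw [hn] at hnonneg
    norm_cast at hnonneg ⊢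
    omega

theorem meromorphicOrderAt_eq_neg_one_iff_of_tendsto_sub_mul (hF : MeromorphicAt F z₀)
    (hR : Tendsto (fun z => (z - z₀) * F z) (𝓝[≠] z₀) (𝓝 R)) :
    meromorphicOrderAt F z₀ = ((-1 : ℤ) : WithTop ℤ) ↔ R ≠ 0 := by
  have hsub : MeromorphicAt (· - z₀) z₀ := by fun_prop
  have horder : meromorphicOrderAt F z₀ = ((-1 : ℤ) : WithTop ℤ) ↔
      meromorphicOrderAt ((· - z₀) * F) z₀ = 0 := by
    rw [meromorphicOrderAt_mul hsub hF, meromorphicOrderAt_id_sub_const]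
    cases meromorphicOrderAt F z₀ with
    | top => exact iff_of_false WithTop.top_ne_coe (by simp)
    | coe n =>
      norm_cast
      omega
  rw [horder, ← tendsto_ne_zero_iff_meromorphicOrderAt_eq_zero (hsub.mul hF)]
  refine ⟨?_, fun h => ⟨R, h, hR⟩⟩
  rintro ⟨c, hc, hlim⟩
  rwa [tendsto_nhds_unique hR hlim]

end SimplePole

/-! ### Monomials in a phase and a translation -/

theorem zpow_eq_of_map_add {A G : Type*} [AddGroup A] [Group G] {f : A → G}
    (hf : ∀ a b, f (a + b) = f a * f b) (a : A) (n : ℤ) : f a ^ n = f (n • a) :=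
  (map_zpow (MonoidHom.mk' (fun a : Multiplicative A => f a.toAdd) fun _ _ => hf _ _)
    (Multiplicative.ofAdd a) n).symm

theorem translation_add (α β : ℝ) : translation (α + β) = translation α * translation β := by
  refine LinearIsometryEquiv.ext fun ξ => Lp.ext ?_
  change translation (α + β) ξ =ᵐ[volume] translation α (translation β ξ)
  have hβ := (measurePreserving_sub_right (volume : Measure ℝ) α).quasiMeasurePreserving.ae
    (coeFn_translation β ξ)
  filter_upwards [coeFn_translation (α + β) ξ, coeFn_translation α (translation β ξ), hβ]
    with x hαβ hα hβ
  rw [hαβ, hα, hβ, sub_sub]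

theorem translation_zpow (α : ℝ) (n : ℤ) : translation α ^ n = translation (n * α) := by
  rw [zpow_eq_of_map_add translation_add, zsmul_eq_mul]

theorem phaseOp_add {f g : ℝ → ℝ} (hf : Measurable f) (hg : Measurable g) :
    phaseOp (fun x => f x + g x) (hf.add hg) = phaseOp f hf * phaseOp g hg := by
  refine LinearIsometryEquiv.ext fun ξ => Lp.ext ?_
  change phaseOp (fun x => f x + g x) (hf.add hg) ξ =ᵐ[volume] phaseOp f hf (phaseOp g hg ξ)
  filter_upwards [coeFn_phaseOp (fun x => f x + g x) (hf.add hg) ξ,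
    coeFn_phaseOp f hf (phaseOp g hg ξ), coeFn_phaseOp g hg ξ] with x hfg hf hg
  rw [hfg, hf, hg, ← mul_assoc, ← exp_add]
  push_cast
  ring_nf

theorem phaseOp_zpow {g : ℝ → ℝ} (hg : Measurable g) (n : ℤ) :
    phaseOp g hg ^ n = phaseOp (fun x => n * g x) (hg.const_mul _) := by
  have hzpow := zpow_eq_of_map_add (f := fun m : ℤ => phaseOp (fun x => m * g x) (hg.const_mul _))
    (fun m n => ?_) 1 n
  · simpa using hzpow
  · simp only [Int.cast_add, add_mul]
    exact phaseOp_add _ _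

/-- The monomial `u^n v^m` of a covariant pair `(u, v)`, for `p = (n, m)`. -/
def monomialOp {ħ : ℝ} (i : CovariantPair ħ) (p : ℤ × ℤ) : Op :=
  ((i.1.1 ^ p.1 : unitary Op) : Op) * ((i.1.2 ^ p.2 : unitary Op) : Op)

theorem monomialOp_eq_mulOp_mul_translation {ħ α : ℝ} {g : ℝ → ℝ} (hg : Measurable g)
    {i : CovariantPair ħ} (hu : i.1.1 = Unitary.linearIsometryEquiv.symm (phaseOp g hg))
    (hv : i.1.2 = Unitary.linearIsometryEquiv.symm (translation α)) (p : ℤ × ℤ) :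
    monomialOp i p = mulOp _ (memLp_phase (fun x => p.1 * g x) (hg.const_mul _)) *
      ((translation (p.2 * α)).toContinuousLinearEquiv : Op) := by
  rw [monomialOp, hu, hv, ← map_zpow, ← map_zpow, phaseOp_zpow, translation_zpow]
  rfl

/-- Evaluation of a bounded family of operators at an index, as a homomorphism of ⋆-monoids; the
⋆-monoid structure is what unitary groups are functorial in. -/
def evalHom (ħ : ℝ) (i : CovariantPair ħ) : BigProduct ħ →⋆* Op where
  toFun a := a i
  map_one' := rfl
  map_mul' _ _ := rfl
  map_star' _ := rfl

theorem coe_familyUnitary_zpow_apply {ħ : ℝ} (w : CovariantPair ħ → unitary Op)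
    (i : CovariantPair ħ) (n : ℤ) :
    ((familyUnitary ħ w ^ n : unitary (BigProduct ħ)) : BigProduct ħ) i =
      ((w i ^ n : unitary Op) : Op) := by
  let φ : unitary (BigProduct ħ) →* unitary Op := (Unitary.map (evalHom ħ i)).toMonoidHom
  have hφ : φ (familyUnitary ħ w) = w i := Subtype.ext rfl
  rw [← hφ, ← map_zpow]
  rfl

/-- `a = ∑ c_{nm} U^n V^m`, with unconditional convergence in norm. -/
def HasFourierSeries {ħ : ℝ} (a : rotationAlgebra ħ) (c : ℤ × ℤ → ℂ) : Prop :=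
  HasSum (fun p : ℤ × ℤ => c p • (((bigU ħ ^ p.1 : unitary (BigProduct ħ)) : BigProduct ħ) *
    ((bigV ħ ^ p.2 : unitary (BigProduct ħ)) : BigProduct ħ))) (a : BigProduct ħ)

theorem HasFourierSeries.hasSum_repOfPair {ħ : ℝ} {a : rotationAlgebra ħ} {c : ℤ × ℤ → ℂ}
    (ha : HasFourierSeries a c) (i : CovariantPair ħ) :
    HasSum (fun p => c p • monomialOp i p) (repOfPair ħ i a) := by
  refine (ha.mapL (lp.evalCLM ℂ (fun _ : CovariantPair ħ => Op) ∞ i)).congr_fun fun p => ?_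
  rw [map_smul, monomialOp, ← coe_familyUnitary_zpow_apply (fun i => i.1.1),
    ← coe_familyUnitary_zpow_apply (fun i => i.1.2)]
  rfl

/-! ### The standard trace -/

theorem integral_Ico_exp_two_pi_mul_int (n : ℤ) :
    ∫ x in Set.Ico (0 : ℝ) 1, exp (2 * Real.pi * (n * x : ℝ) * I) = if n = 0 then 1 else 0 := by
  have hexponent (x : ℝ) : (2 * Real.pi * (n * x : ℝ) * I : ℂ) = n * (2 * Real.pi * I) * x := by
    push_cast
    ring
  simp only [hexponent]
  rw [integral_Ico_eq_integral_Ioc, ← intervalIntegral.integral_of_le zero_le_one]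
  split_ifs with hn
  · simp [hn]
  · rw [integral_exp_mul_complex (mul_ne_zero (Int.cast_ne_zero.mpr hn) two_pi_I_ne_zero),
      ofReal_one, mul_one, exp_int_mul_two_pi_mul_I, ofReal_zero, mul_zero, exp_zero, sub_self,
      zero_div]

theorem coeFn_unitCell : unitCell =ᵐ[volume] fun x => if ⌊x⌋ = 0 then 1 else 0 := by
  refine indicatorConstLp_coeFn.trans (.of_forall fun x => ?_)
  simp only [Set.indicator_apply, Int.floor_eq_zero_iff]

theorem vectorFunctional_unitCell_monomialOp_regularPair (ħ : ℝ) (p : ℤ × ℤ) :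
    vectorFunctional ℂ unitCell (monomialOp (regularPair ħ) p) = if p = 0 then 1 else 0 := by
  obtain ⟨n, m⟩ := p
  have hcell := (measurePreserving_sub_right (volume : Measure ℝ)
    (m * 1)).quasiMeasurePreserving.ae coeFn_unitCell
  have hphase := memLp_phase _ ((measurable_regularPhase ħ).const_mul (n : ℝ))
  have hpointwise : (fun x => inner ℂ (unitCell x) (monomialOp (regularPair ħ) (n, m) unitCell x))
      =ᵐ[volume] (Set.Ico (0 : ℝ) 1).indicator fun x =>
        exp (2 * Real.pi * (n * x : ℝ) * I) * if m = 0 then 1 else 0 := by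
    rw [monomialOp_eq_mulOp_mul_translation (measurable_regularPhase ħ) rfl rfl]
    filter_upwards [coeFn_mulOp _ hphase (translation (m * 1) unitCell),
      coeFn_translation (m * 1) unitCell, coeFn_unitCell, hcell] with x hmul htrans hx hxm
    change inner ℂ (unitCell x) (mulOp _ hphase (translation (m * 1) unitCell) x) = _
    rw [hmul, htrans, hx, hxm, mul_one, Int.floor_sub_intCast, RCLike.inner_apply]
    by_cases hfloor : ⌊x⌋ = 0
    · have hfract : Int.fract x = x := by rw [Int.fract, hfloor, Int.cast_zero, sub_zero]
      simp [hfloor, hfract, Set.indicator_of_mem (Int.floor_eq_zero_iff.mp hfloor)]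
    · simp [hfloor, Set.indicator_of_notMem (mt Int.floor_eq_zero_iff.mpr hfloor)]
  rw [vectorFunctional_apply, L2.inner_def, integral_congr_ae hpointwise,
    integral_indicator measurableSet_Ico, integral_mul_const, integral_Ico_exp_two_pi_mul_int]
  simp only [Prod.mk_eq_zero, ← ite_and, mul_ite, mul_one, mul_zero, and_comm]

theorem HasFourierSeries.standardTrace_eq {ħ : ℝ} {a : rotationAlgebra ħ} {c : ℤ × ℤ → ℂ}
    (ha : HasFourierSeries a c) : standardTrace ħ a = c 0 := by
  have hsum := (ha.hasSum_repOfPair (regularPair ħ)).mapL (vectorFunctional ℂ unitCell)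
  refine hsum.unique ((hasSum_ite_eq 0 (c 0)).congr_fun fun p => ?_)
  rw [map_smul, vectorFunctional_unitCell_monomialOp_regularPair, smul_eq_mul, mul_ite, mul_one,
    mul_zero]
  split_ifs with hp
  · rw [hp]
  · rfl

/-! ### Monomials in the Heisenberg pair -/

/-- The constant `d` for which the heat trace of the monomial `U^n V^m` has modulus
`e^{-d / tanh y} / (2 sinh y)`, for `p = (n, m)`. -/
def monomialDecay (ħ : ℝ) (p : ℤ × ℤ) : ℝ :=
  ((2 * Real.pi * p.1) ^ 2 + (p.2 * ħ) ^ 2) / 4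

theorem monomialDecay_eq_zero_iff {ħ : ℝ} {p : ℤ × ℤ} :
    monomialDecay ħ p = 0 ↔ p.1 = 0 ∧ p.2 * ħ = 0 := by
  rw [monomialDecay, div_eq_zero_iff, or_iff_left four_ne_zero,
    add_eq_zero_iff_of_nonneg (sq_nonneg _) (sq_nonneg _), sq_eq_zero_iff, sq_eq_zero_iff,
    mul_eq_zero_iff_left Real.two_pi_pos.ne', Int.cast_eq_zero]

theorem norm_heatTrace_monomialOp_heisenbergPair {y : ℝ} (hy : 0 < y) (ħ : ℝ) (p : ℤ × ℤ) :
    ‖heatTrace y (monomialOp (heisenbergPair ħ) p)‖ =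
      (2 * Real.sinh y)⁻¹ * Real.exp (-(monomialDecay ħ p / Real.tanh y)) := by
  have hphase (x : ℝ) : exp (2 * Real.pi * (p.1 * x : ℝ) * I) =
      exp ((2 * Real.pi * p.1 : ℝ) * x * I) := by
    push_cast
    ring_nf
  have hunit : ‖exp ((2 * Real.pi * p.1 : ℝ) * (p.2 * ħ : ℝ) / 2 * I)‖ = 1 := by
    simpa using norm_exp_ofReal_mul_I (2 * Real.pi * p.1 * (p.2 * ħ) / 2)
  rw [monomialOp_eq_mulOp_mul_translation measurable_id rfl rfl,
    heatTrace_mulOp_mul_translation hy]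
  simp only [id, hphase]
  rw [integral_cexp_mul_heatKernel hy, norm_mul, hunit, one_mul, norm_real,
    Real.norm_of_nonneg (by positivity), monomialDecay, div_div]

theorem monomialOp_heisenbergPair_eq_one {ħ : ℝ} {p : ℤ × ℤ} (hp : monomialDecay ħ p = 0) :
    monomialOp (heisenbergPair ħ) p = 1 := by
  obtain ⟨hn, hm⟩ := monomialDecay_eq_zero_iff.mp hp
  have htranslation : (heisenbergPair ħ).1.2 ^ p.2 = 1 := by
    change Unitary.linearIsometryEquiv.symm (translation ħ) ^ p.2 = 1
    rw [← map_zpow, translation_zpow, hm, ← zero_mul ħ, ← Int.cast_zero, ← translation_zpow,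
      zpow_zero, map_one]
  rw [monomialOp, hn, zpow_zero, htranslation, OneMemClass.coe_one, mul_one]

theorem one_le_intCast_sq {n : ℤ} (hn : n ≠ 0) : (1 : ℝ) ≤ (n : ℝ) ^ 2 :=
  (one_le_sq_iff_one_le_abs _).mpr (mod_cast Int.one_le_abs hn)

theorem exists_pos_forall_le_monomialDecay (ħ : ℝ) :
    ∃ r, 0 < r ∧ ∀ p, monomialDecay ħ p ≠ 0 → r ≤ monomialDecay ħ p := by
  have hfreq {p : ℤ × ℤ} (hn : p.1 ≠ 0) : 1 ≤ monomialDecay ħ p := by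
    have hsq := one_le_intCast_sq hn
    have hpi := Real.pi_gt_three
    rw [monomialDecay, mul_pow]
    nlinarith [sq_nonneg (p.2 * ħ)]
  obtain rfl | hħ := eq_or_ne ħ 0
  · refine ⟨1, one_pos, fun p hp => hfreq fun hn => hp ?_⟩
    exact monomialDecay_eq_zero_iff.mpr ⟨hn, mul_zero _⟩
  · refine ⟨min 1 (ħ ^ 2 / 4), by positivity, fun p hp => ?_⟩
    by_cases hn : p.1 = 0
    · have hm : p.2 ≠ 0 := fun hm => hp (monomialDecay_eq_zero_iff.mpr ⟨hn, by simp [hm]⟩)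
      refine min_le_of_right_le ?_
      rw [monomialDecay, hn, mul_pow _ ħ]
      nlinarith [one_le_intCast_sq hm, sq_nonneg ħ]
    · exact min_le_of_left_le (hfreq hn)

/-! ### The spectral zeta function of an absolutely convergent Fourier series -/

/-- The coefficient of the identity in `∑ c_{nm} U^n V^m` acting on `L²(ℝ)`. For `ħ = 0` every
`V^m` acts as the identity, so that this is not just `c_{00}`. -/
def scalarCoeff (ħ : ℝ) (c : ℤ × ℤ → ℂ) : ℂ :=
  ∑' p, {p | monomialDecay ħ p = 0}.indicator c p

theorem scalarCoeff_of_ne_zero {ħ : ℝ} (hħ : ħ ≠ 0) (c : ℤ × ℤ → ℂ) :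
    scalarCoeff ħ c = c 0 := by
  have hscalar : {p | monomialDecay ħ p = 0} = {0} := by
    ext p
    simp [monomialDecay_eq_zero_iff, hħ, Prod.ext_iff]
  rw [scalarCoeff, hscalar, ← tsum_subtype, tsum_singleton]

theorem hasSum_sub_scalarCoeff {ħ : ℝ} {c : ℤ × ℤ → ℂ} (hc : Summable fun p => ‖c p‖) {T : Op}
    (hT : HasSum (fun p => c p • monomialOp (heisenbergPair ħ) p) T) :
    HasSum (fun p => {p | monomialDecay ħ p ≠ 0}.indicator c p • monomialOp (heisenbergPair ħ) p)
      (T - scalarCoeff ħ c • 1) := by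
  refine (hT.sub ((hc.of_norm.indicator _).hasSum.smul_const (1 : Op))).congr_fun fun p => ?_
  by_cases hp : monomialDecay ħ p = 0
  · simp [hp, monomialOp_heisenbergPair_eq_one]
  · simp [hp]

theorem exists_entire_isSpectralZeta_sub_scalarCoeff {ħ : ℝ} {c : ℤ × ℤ → ℂ}
    (hc : Summable fun p => ‖c p‖) {T : Op}
    (hT : HasSum (fun p => c p • monomialOp (heisenbergPair ħ) p) T) :
    ∃ F : ℂ → ℂ, Differentiable ℂ F ∧ IsSpectralZeta (T - scalarCoeff ħ c • 1) F := by
  obtain ⟨r, hr, hdecay⟩ := exists_pos_forall_le_monomialDecay ħ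
  refine exists_entire_isSpectralZeta (C := ∑' p, ‖c p‖) hr fun y hy => ?_
  have htanh := tanh_pos hy
  refine ((hasSum_sub_scalarCoeff hc hT).mapL (heatTrace y)).norm_le_of_bounded
    (hc.hasSum.mul_right _) fun p => ?_
  rw [map_smul, norm_smul, norm_heatTrace_monomialOp_heisenbergPair hy]
  by_cases hp : monomialDecay ħ p = 0
  · rw [Set.indicator_of_notMem (not_not.mpr hp), norm_zero, zero_mul]
    positivity
  · rw [Set.indicator_of_mem hp]
    gcongr
    exact hdecay p hp

theorem exists_isSpectralZeta_of_hasSum_monomialOp {ħ : ℝ} {c : ℤ × ℤ → ℂ}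
    (hc : Summable fun p => ‖c p‖) {T : Op}
    (hT : HasSum (fun p => c p • monomialOp (heisenbergPair ħ) p) T) :
    ∃ F : ℂ → ℂ, IsSpectralZeta T F ∧ (∀ s, s ≠ 1 → DifferentiableAt ℂ F s) ∧
      Tendsto (fun s => (s - 1) * F s) (𝓝[≠] 1) (𝓝 (scalarCoeff ħ c / 2)) := by
  obtain ⟨G, hG, hGzeta⟩ := exists_entire_isSpectralZeta_sub_scalarCoeff hc hT
  have hpow : Differentiable ℂ fun s : ℂ => (2 : ℂ) ^ (-s) := fun s =>
    differentiableAt_id.neg.const_cpow (.inl two_ne_zero)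
  have hzeta := hGzeta.add (isSpectralZeta_one.const_smul (scalarCoeff ħ c))
  rw [sub_add_cancel] at hzeta
  refine ⟨_, hzeta, fun s hs => ?_, ?_⟩
  · exact (hG s).add (((hpow s).mul
      (HurwitzZeta.differentiableAt_hurwitzZeta _ hs)).const_smul _)
  · have hentire : Tendsto (fun s => (s - 1) * G s) (𝓝[≠] 1) (𝓝 ((1 - 1) * G 1)) :=
      ((continuous_id.sub continuous_const).mul hG.continuous).continuousAt.tendsto.mono_left
        nhdsWithin_le_nhds
    have hpole := ((hpow.continuous.tendsto 1).mono_left nhdsWithin_le_nhds).mul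
      (HurwitzZeta.hurwitzZeta_residue_one ((1 / 2 : ℝ) : UnitAddCircle))
    convert! hentire.add (hpole.const_mul (scalarCoeff ħ c)) using 2 with s
    · simp only [Pi.add_apply, Pi.smul_apply, smul_eq_mul]
      ring
    · rw [cpow_neg_one]
      ring

theorem exists_entire_isSpectralZeta_mulOp_mul_translation {g : ℝ → ℂ} (hg : MemLp g ∞ volume)
    {α : ℝ} (hα : α ≠ 0) :
    ∃ F : ℂ → ℂ, Differentiable ℂ F ∧
      IsSpectralZeta (mulOp g hg * ((translation α).toContinuousLinearEquiv : Op)) F :=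
  exists_entire_isSpectralZeta (r := α ^ 2 / 4) (by positivity) fun y hy => by
    simpa only [div_div] using norm_heatTrace_mulOp_mul_translation_le hy hg α

end Heisenberg

end

open Heisenberg in
theorem mainTheorem5_general :
    (∀ (ħ : ℝ) (a : rotationAlgebra ħ) (c : ℤ × ℤ → ℂ), HasFourierSeries a c →
      (Summable fun p => ‖c p‖) → ∃ F : ℂ → ℂ,
      (∀ s : ℂ, 1 < s.re → HasTrace (heisenbergRep ħ a * oscillatorPow s) (F s)) ∧
      MeromorphicOn F Set.univ ∧
      AnalyticOnNhd ℂ F {1}ᶜ ∧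
      ((-1 : ℤ) : WithTop ℤ) ≤ meromorphicOrderAt F 1 ∧
      (ħ ≠ 0 →
        Tendsto (fun s => (s - 1) * F s) (𝓝[≠] 1) (𝓝 (standardTrace ħ a / 2)) ∧
        (meromorphicOrderAt F 1 = ((-1 : ℤ) : WithTop ℤ) ↔ standardTrace ħ a ≠ 0))) ∧
    (∀ (f : ℝ → ℂ) (hf : MemLp f ∞ volume) (α : ℝ), α ≠ 0 →
      ∃ F : ℂ → ℂ, Differentiable ℂ F ∧ ∀ s : ℂ, 1 < s.re →
        HasTrace (mulOp f hf * ((translation α).toContinuousLinearEquiv : Op) *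
          oscillatorPow s) (F s)) := by
  refine ⟨fun ħ a c ha hc => ?_, fun f hf α hα => ?_⟩
  · obtain ⟨F, hzeta, hF, hres⟩ := exists_isSpectralZeta_of_hasSum_monomialOp hc
      (ha.hasSum_repOfPair (heisenbergPair ħ))
    have hmero := meromorphicAt_of_tendsto_sub_mul hF hres
    refine ⟨F, fun s hs => hzeta.hasTrace hs, meromorphicOn_univ_of_tendsto_sub_mul hF hres,
      DifferentiableOn.analyticOnNhd (fun s hs => (hF s hs).differentiableWithinAt)
        isOpen_compl_singleton,
      neg_one_le_meromorphicOrderAt_of_tendsto_sub_mul hmero hres, fun hħ => ?_⟩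
    rw [scalarCoeff_of_ne_zero hħ, ← ha.standardTrace_eq] at hres
    refine ⟨hres, (meromorphicOrderAt_eq_neg_one_iff_of_tendsto_sub_mul hmero hres).trans ?_⟩
    exact div_ne_zero_iff.trans (and_iff_left two_ne_zero)
  · obtain ⟨F, hF, hzeta⟩ := exists_entire_isSpectralZeta_mulOp_mul_translation hf hα
    exact ⟨F, hF, fun s hs => hzeta.hasTrace hs⟩

theorem mainTheorem5 :
    (∀ (ħ : ℝ), ∀ a ∈ Heisenberg.schwartzAlgebra ħ, ∃ F : ℂ → ℂ,
      (∀ s : ℂ, 1 < s.re →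
        Heisenberg.HasTrace (Heisenberg.heisenbergRep ħ a * Heisenberg.oscillatorPow s) (F s)) ∧
      MeromorphicOn F Set.univ ∧
      AnalyticOnNhd ℂ F {1}ᶜ ∧
      ((-1 : ℤ) : WithTop ℤ) ≤ meromorphicOrderAt F 1 ∧
      (ħ ≠ 0 →
        Tendsto (fun s => (s - 1) * F s) (𝓝[≠] 1) (𝓝 (Heisenberg.standardTrace ħ a / 2)) ∧
        (meromorphicOrderAt F 1 = ((-1 : ℤ) : WithTop ℤ) ↔ Heisenberg.standardTrace ħ a ≠ 0))) ∧
    (∀ f : BoundedContinuousFunction ℝ ℂ, UniformContinuous f → ∀ α : ℝ, α ≠ 0 →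
      ∃ F : ℂ → ℂ, Differentiable ℂ F ∧ ∀ s : ℂ, 1 < s.re →
        Heisenberg.HasTrace
          (Heisenberg.mulOp (fun x => f x) (Heisenberg.memLp_boundedContinuous f) *
            ((Heisenberg.translation α).toContinuousLinearEquiv : Heisenberg.Op) *
            Heisenberg.oscillatorPow s) (F s)) := by
  refine ⟨fun ħ a ⟨c, hc, ha⟩ => mainTheorem5_general.1 ħ a c ha (by simpa using hc 0), ?_⟩
  exact fun f _ α hα => mainTheorem5_general.2 f (Heisenberg.memLp_boundedContinuous f) α hα
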